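/- Let $\zeta(a,x)=\sum_{k\ge0}(k+x)^{-a}$ be the Hurwitz zeta function, $\zeta(a)=\zeta(a,1)$, and $B(u,v)=\Gamma(u)\Gamma(v)/\Gamma(u+v)$. (1) For $1<\alpha\le 2$ the function $$x\mapsto [2\zeta(\alpha)-\zeta(\alpha,x)-\zeta(\alpha,1-x)]^2-x^{-2\alpha}-(1-x)^{-2\alpha}$$ is integrable on $(0,1)$, and its integral $K(\alpha)$ satisfies $$K(\alpha)=4\zeta(\alpha)^2+2\zeta(2\alpha-1)\{2B(1-\alpha,2\alpha-1)+B(1-\alpha,1-\alpha)\}+\frac{2}{2\alpha-1},$$ where at $\alpha=2$, a removable singularity, the right-hand side means its limit as $\alpha\to2$. (2) Let $0\le\varepsilon<1$ and, for $r,h\in\mathbb R$ not both zero, $G_b(r;h)=C\,(r^2+h^2)^{(-2+\varepsilon)/2}$ with $C=\frac14\pi^{-2+\varepsilon/2}\Gamma(1-\varepsilon/2)$. Put $$G_D(r;z_1,z_2)=G_b(r;|z_1-z_2|)-G_b(r;z_1+z_2),$$ $$G^L_D(r;z_1,z_2)=\sum_{n\in\mathbb Z}\left[G_b(r;|z_1-z_2+2Ln|)-G_b(r;z_1+z_2+2Ln)\right].$$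 For $L>0$ the series converges absolutely for all $r>0$ and $z_1,z_2\in\mathbb R$, and the limits $$D(z)=\lim_{r\to0^+}[G_D(r;z,z)-G_b(r;0)]\quad(z>0),\qquad D^L(z)=\lim_{r\to0^+}[G^L_D(r;z,z)-G_b(r;0)]\quad(0<z<L)$$ exist. The integrals in $$E_1(g,\mu,L)=\tfrac18\,g\mu^{\varepsilon}\Big[\int_0^L\{D^L(z)^2-D(z)^2-D(L-z)^2\}\,dz-2\int_L^\infty D(z)^2\,dz\Big]$$ converge absolutely. There is exactly one real number $c_1(\varepsilon)$ (Symanzik's $O(g)$ Casimir coefficient) such that, for all $\mu,L>0$ and every function $\bar g$ of $g>0$ with $\bar g=g(\mu L)^{\varepsilon}+O(g^2)$ as $g\to0^+$, $$L^{-3+\varepsilon}c_1(\varepsilon)\,\bar g=E_1(g,\mu,L)+O(g^2)\qquad(g\to0^+).$$ It is given by $$c_1(\varepsilon)=\tfrac12(4\pi)^{-4+\varepsilon}\,\Gamma(1-\tfrac{\varepsilon}{2})^2\left[\zeta(2-\varepsilon)^2+(1-\cos\pi\varepsilon)\,B(3-2\varepsilon,-1+\varepsilon)\,\zeta(3-2\varepsilon)\right],$$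 where at $\varepsilon=0$, a removable singularity, the right-hand side means its limit as $\varepsilon\to0$. -/

import Mathlib

open Filter Topology Set MeasureTheory Asymptotics

noncomputable section

namespace Casimir

/-- The Euler beta function `B(u, v) = Γ(u) Γ(v) / Γ(u + v)`. At a pole of `Γ(u + v)`, where
`1 / Γ` vanishes, the quotient is `0`, as it should be (if `u`, `v` are not poles of `Γ`);
at the poles of `Γ(u)` or `Γ(v)` this expression is not used. -/
def beta (u v : ℂ) : ℂ :=
  Complex.Gamma u * Complex.Gamma v / Complex.Gamma (u + v)

/-- The integrand of `K(α)`. Mathlib's `HurwitzZeta.hurwitzZeta x α` is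
`∑ k, 1 / (k + x) ^ α` for `0 < x < 1` and `α > 1`. -/
def integrandK (α x : ℝ) : ℂ :=
  (2 * riemannZeta α - HurwitzZeta.hurwitzZeta (x : UnitAddCircle) α
      - HurwitzZeta.hurwitzZeta ((1 - x : ℝ) : UnitAddCircle) α) ^ 2
    - (x : ℂ) ^ (-2 * α : ℂ) - (1 - x : ℂ) ^ (-2 * α : ℂ)

/-- The integral `K(α)`. -/
def K (α : ℝ) : ℂ := ∫ x in (0 : ℝ)..1, integrandK α x

/-- The closed form for `K(α)`; it has a removable singularity at `α = 2`. -/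
def closedFormK (α : ℝ) : ℂ :=
  4 * riemannZeta α ^ 2
    + 2 * riemannZeta (2 * α - 1)
        * (2 * beta (1 - α) (2 * α - 1) + beta (1 - α) (1 - α))
    + 2 / (2 * α - 1)

/-- The free massless propagator in `d = 4 - ε` dimensions,
`(1/4) π ^ (-2 + ε/2) Γ(1 - ε/2) x ^ (-2 + ε)`, at distance `x = √(r² + h²)`
(`r` the separation parallel to the plates, `h` the perpendicular one). -/
def bulkPropagator (ε r h : ℝ) : ℝ :=
  1 / 4 * Real.pi ^ (-2 + ε / 2) * Real.Gamma (1 - ε / 2) * √(r ^ 2 + h ^ 2) ^ (-2 + ε)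

/-- The Dirichlet propagator in the half space bounded by one plane. -/
def halfSpacePropagator (ε r z₁ z₂ : ℝ) : ℝ :=
  bulkPropagator ε r |z₁ - z₂| - bulkPropagator ε r (z₁ + z₂)

/-- The `n`-th term of the image series of the film propagator. -/
def filmTerm (ε L r z₁ z₂ : ℝ) (n : ℤ) : ℝ :=
  bulkPropagator ε r |z₁ - z₂ + 2 * L * n| - bulkPropagator ε r (z₁ + z₂ + 2 * L * n)

/-- The Dirichlet-Dirichlet propagator in the film `0 ≤ z ≤ L`. -/
def filmPropagator (ε L r z₁ z₂ : ℝ) : ℝ := ∑' n : ℤ, filmTerm ε L r z₁ z₂ n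

/-- `G_D(0; z, z) - G_b(0)`: both terms are infinite at coincident points, and the difference is
the limit as the points approach each other parallel to the plane. -/
def halfSpaceSubtracted (ε z : ℝ) : ℝ :=
  limUnder (𝓝[>] (0 : ℝ)) fun r => halfSpacePropagator ε r z z - bulkPropagator ε r 0

/-- `G_D^L(0; z, z) - G_b(0)`, as a limit in the same sense. -/
def filmSubtracted (ε L z : ℝ) : ℝ :=
  limUnder (𝓝[>] (0 : ℝ)) fun r => filmPropagator ε L r z z - bulkPropagator ε r 0

/-- The integrand over the film in the two-loop diagram. -/
def filmIntegrand (ε L z : ℝ) : ℝ :=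
  filmSubtracted ε L z ^ 2 - halfSpaceSubtracted ε z ^ 2 - halfSpaceSubtracted ε (L - z) ^ 2

/-- The contribution of first order in `g` to the Casimir energy per unit area. -/
def firstOrderEnergy (ε g μ L : ℝ) : ℝ :=
  1 / 8 * g * μ ^ ε *
    ((∫ z in (0 : ℝ)..L, filmIntegrand ε L z)
      - 2 * ∫ z in Ioi L, halfSpaceSubtracted ε z ^ 2)

/-- `gbar`, as a function of `g > 0` at fixed `μ`, `L`, `ε`, is a running coupling with the
standard normalization `gbar = g (μ L) ^ ε + O(g²)` as `g → 0`. -/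
def IsRunningCoupling (ε μ L : ℝ) (gbar : ℝ → ℝ) : Prop :=
  (fun g => gbar g - g * (μ * L) ^ ε) =O[𝓝[>] 0] fun g : ℝ => g ^ 2

/-- `c` is the first-order Casimir coefficient:
`L ^ (-3 + ε) * c * gbar = (first-order energy) + O(g²)` for all `μ, L > 0`. -/
def IsFirstCasimirCoefficient (ε c : ℝ) : Prop :=
  ∀ μ L : ℝ, 0 < μ → 0 < L → ∀ gbar : ℝ → ℝ, IsRunningCoupling ε μ L gbar →
    (fun g => L ^ (-3 + ε) * c * gbar g - firstOrderEnergy ε g μ L)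
      =O[𝓝[>] 0] fun g : ℝ => g ^ 2

/-- The closed form for `c₁(ε)`; it has a removable singularity at `ε = 0`. -/
def closedFormC (ε : ℝ) : ℂ :=
  1 / 2 * (4 * Real.pi : ℂ) ^ (-4 + ε : ℂ) * Complex.Gamma (1 - ε / 2) ^ 2
    * (riemannZeta (2 - ε) ^ 2
      + (1 - Complex.cos (Real.pi * ε)) * beta (3 - 2 * ε) (-1 + ε) * riemannZeta (3 - 2 * ε))

end Casimir

end

noncomputable section

namespace Casimir

/-! Let S_a(x) = ∑_{n∈ℤ} |x+n|^(-a), a zero base contributing 0 (`latticeSum`). Then 2ζ(a) = S_a(0)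
and ζ(a,x) + ζ(a,1-x) = S_a(x), so the integrand of K is (S_a(0) - S_a(x))² - x^(-2a) - (1-x)^(-2a)
(`kern`). Expanding the square and grouping pairs of lattice points by their difference k turns
this, up to the constant S_a(0)², into a sum over k and n of `cellTerm a k (x + n)`
(`hasSum_cellTerm`). Integrating all integer translates over a period unfolds to an integral over ℝ
(`integral_tsum_translates`). For k ≠ 0, scaling by k leaves |k|^(1-2a) ∫ `regProd a`, and the sum
over k is 2ζ(2a-1); k = 0 gives 2/(2a-1). The powers subtracted in `regProd` make the integral of
|x|^(-a) |x+1|^(-a) converge for 1 < a < 2 and do not change its analytically continued value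
2B(1-a,2a-1) + B(1-a,1-a) (`ofReal_integral_regProd`).

At a = 2 this convergence fails, but `kern` is bounded uniformly for 1 < a ≤ 2 (`abs_kern_le`), so
K(a) tends to K(2) from the left. The closed form is meromorphic, so a finite one-sided limit
excludes a pole (`tendsto_nhdsNE_of_meromorphicAt`).

For the Casimir coefficient put a = 2 - ε. The image sums are lattice sums, and the film integrand
is a constant times `kern` at z/L. The tail beyond L removes the term 2/(2a-1), and the reflection
formula for Γ merges the two beta functions into one with the factor 1 - cos πε (`beta_reflection`).
-/

/-! ### Euler beta integrals in real variables -/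

/-- The Euler beta integral over the unit interval, in real variables. -/
theorem integrableOn_and_integral_beta_unit {u v : ℝ} (hu : 0 < u) (hv : 0 < v) :
    IntegrableOn (fun x : ℝ => x ^ (u - 1) * (1 - x) ^ (v - 1)) (Ioo 0 1) ∧
      ∫ x in Ioo (0 : ℝ) 1, x ^ (u - 1) * (1 - x) ^ (v - 1)
        = Real.Gamma u * Real.Gamma v / Real.Gamma (u + v) := by
  have hc := Complex.betaIntegral_convergent (u := (u : ℂ)) (v := (v : ℂ)) (by simpa) (by simpa)
  have hI : Complex.betaIntegral u v = _ :=
    Complex.betaIntegral_eq_Gamma_mul_div (u := (u : ℂ)) (v := (v : ℂ)) (by simpa) (by simpa)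
  have key : ∀ x ∈ Ioo (0 : ℝ) 1, (x : ℂ) ^ ((u : ℂ) - 1) * (1 - (x : ℂ)) ^ ((v : ℂ) - 1)
      = ((x ^ (u - 1) * (1 - x) ^ (v - 1) : ℝ) : ℂ) := by
    intro x hx
    rw [Complex.ofReal_mul, Complex.ofReal_cpow hx.1.le,
      Complex.ofReal_cpow (sub_nonneg.2 hx.2.le)]
    push_cast
    rfl
  rw [intervalIntegrable_iff_integrableOn_Ioo_of_le zero_le_one] at hc
  have hc' := (integrableOn_congr_fun key measurableSet_Ioo).1 hc
  have h1 : IntegrableOn (fun x : ℝ => x ^ (u - 1) * (1 - x) ^ (v - 1)) (Ioo 0 1) := by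
    simpa [IntegrableOn] using hc'.re
  refine ⟨h1, ?_⟩
  rw [Complex.betaIntegral, intervalIntegral.integral_of_le zero_le_one,
    integral_Ioc_eq_integral_Ioo, setIntegral_congr_fun measurableSet_Ioo key,
    integral_complex_ofReal, Complex.Gamma_ofReal, Complex.Gamma_ofReal, ← Complex.ofReal_add,
    Complex.Gamma_ofReal] at hI
  exact_mod_cast hI

/-- The Euler beta integral over the half line, in real variables. -/
theorem integrableOn_and_integral_beta_halfLine {u v : ℝ} (hu : 0 < u) (hv : 0 < v) :
    IntegrableOn (fun x : ℝ => x ^ (u - 1) * (1 + x) ^ (-u - v)) (Ioi 0) ∧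
      ∫ x in Ioi (0 : ℝ), x ^ (u - 1) * (1 + x) ^ (-u - v)
        = Real.Gamma u * Real.Gamma v / Real.Gamma (u + v) := by
  have hder : ∀ t ∈ Ioo (0 : ℝ) 1,
      HasDerivWithinAt (fun t : ℝ => t / (1 - t)) (((1 - t) ^ 2)⁻¹) (Ioo 0 1) t := by
    intro t ht
    have h1 : (1 - t) ≠ 0 := by linarith [ht.2]
    have := ((hasDerivAt_id t).div ((hasDerivAt_id t).const_sub 1) h1).hasDerivWithinAt
      (s := Ioo 0 1)
    convert! this using 1
    simp only [id]
    field_simp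
    ring
  have hinj : InjOn (fun t : ℝ => t / (1 - t)) (Ioo 0 1) := by
    intro a ha b hb hab
    have h1 : (1 - a) ≠ 0 := by linarith [ha.2]
    have h2 : (1 - b) ≠ 0 := by linarith [hb.2]
    simp only at hab
    rw [div_eq_div_iff h1 h2] at hab
    linarith
  have himg : (fun t : ℝ => t / (1 - t)) '' Ioo 0 1 = Ioi 0 := by
    ext x
    constructor
    · rintro ⟨t, ht, rfl⟩
      exact div_pos ht.1 (by linarith [ht.2])
    · intro hx
      have hx : 0 < x := hx
      refine ⟨x / (1 + x), ⟨by positivity, by rw [div_lt_one (by positivity)]; linarith⟩, ?_⟩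
      simp only
      field_simp
      ring
  have key : ∀ t ∈ Ioo (0 : ℝ) 1,
      |((1 - t) ^ 2)⁻¹| • ((t / (1 - t)) ^ (u - 1) * (1 + t / (1 - t)) ^ (-u - v))
        = t ^ (u - 1) * (1 - t) ^ (v - 1) := by
    intro t ht
    have h0 : 0 < 1 - t := by linarith [ht.2]
    have h1 : 1 + t / (1 - t) = (1 - t)⁻¹ := by field_simp; ring
    rw [h1, Real.div_rpow ht.1.le h0.le, Real.inv_rpow h0.le, ← Real.rpow_neg h0.le,
      abs_of_pos (by positivity), ← Real.rpow_natCast, ← Real.rpow_neg h0.le, div_eq_mul_inv,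
      ← Real.rpow_neg h0.le, smul_eq_mul]
    have : (1 - t) ^ (v - 1) = (1 - t) ^ (-((2 : ℕ) : ℝ)) * (1 - t) ^ (-(u - 1))
        * (1 - t) ^ (-(-u - v)) := by
      rw [← Real.rpow_add h0, ← Real.rpow_add h0]
      congr 1
      push_cast
      ring
    rw [this]
    ring
  obtain ⟨h1, h2⟩ := integrableOn_and_integral_beta_unit hu hv
  constructor
  · rw [← himg, integrableOn_image_iff_integrableOn_abs_deriv_smul measurableSet_Ioo hder hinj]
    exact (integrableOn_congr_fun key measurableSet_Ioo).2 h1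
  · rw [← h2, ← himg, integral_image_eq_integral_abs_deriv_smul measurableSet_Ioo hder hinj]
    exact setIntegral_congr_fun measurableSet_Ioo key

/-! ### Regularized integrals of products of powers -/

/-- The Euler beta function on real arguments. -/
def realBeta (u v : ℝ) : ℝ := Real.Gamma u * Real.Gamma v / Real.Gamma (u + v)

/-- The worst case is a = 2, where 1 - (1+x)^(-2) = x(2+x)/(1+x)². The factor x/(1+x) is small at 0
and bounded at infinity, so multiplying by x^(-a) gives a convergent beta integrand. -/
theorem one_sub_rpow_neg_bounds {a x : ℝ} (ha : 0 ≤ a) (ha' : a ≤ 2) (hx : 0 ≤ x) :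
    0 ≤ 1 - (1 + x) ^ (-a) ∧ 1 - (1 + x) ^ (-a) ≤ 2 * (x * (1 + x)⁻¹) := by
  constructor
  · linarith [Real.rpow_le_one_of_one_le_of_nonpos (x := 1 + x) (z := -a) (by linarith)
      (by linarith)]
  · have h1 : (1 + x) ^ (-2 : ℝ) ≤ (1 + x) ^ (-a) :=
      Real.rpow_le_rpow_of_exponent_le (by linarith) (by linarith)
    have h2 : (1 + x) ^ (-2 : ℝ) = ((1 + x) ^ 2)⁻¹ := by
      rw [Real.rpow_neg (by linarith)]
      norm_cast
    have h3 : 1 - ((1 + x) ^ 2)⁻¹ ≤ 2 * (x * (1 + x)⁻¹) := by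
      have : 2 * (x * (1 + x)⁻¹) - (1 - ((1 + x) ^ 2)⁻¹) = x ^ 2 / (1 + x) ^ 2 := by
        field_simp
        ring
      have h4 : 0 ≤ x ^ 2 / (1 + x) ^ 2 := by positivity
      linarith
    linarith

theorem integrableOn_rpow_mul_rpow_sub_one {a : ℝ} (ha : 1 < a) (ha' : a < 2) :
    IntegrableOn (fun x : ℝ => x ^ (-a) * ((1 + x) ^ (-a) - 1)) (Ioi 0) := by
  have h := (integrableOn_and_integral_beta_halfLine (u := 2 - a) (v := a - 1) (by linarith)
    (by linarith)).1.const_mul 2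
  refine Integrable.mono' h (by
    refine Measurable.aestronglyMeasurable ?_
    fun_prop) ?_
  refine (ae_restrict_mem measurableSet_Ioi).mono fun x hx => ?_
  have hx : 0 < x := hx
  have hb := one_sub_rpow_neg_bounds (a := a) (by linarith) ha'.le hx.le
  rw [norm_mul, Real.norm_of_nonneg (by positivity), Real.norm_eq_abs, abs_sub_comm,
    abs_of_nonneg hb.1]
  have e1 : x ^ (2 - a - 1) = x ^ (-a) * x := by
    rw [show 2 - a - 1 = -a + 1 by ring, Real.rpow_add_one hx.ne']
  have e2 : (1 + x) ^ (-(2 - a) - (a - 1)) = (1 + x)⁻¹ := by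
    rw [show -(2 - a) - (a - 1) = -1 by ring, Real.rpow_neg_one]
  rw [e1, e2]
  calc x ^ (-a) * (1 - (1 + x) ^ (-a)) ≤ x ^ (-a) * (2 * (x * (1 + x)⁻¹)) := by
        gcongr
        exact hb.2
    _ = _ := by ring

/-- Integration by parts with F = x^(1-a) ((1+x)^(-a) - 1). F is O(x^(2-a)) at 0 and O(x^(1-a)) at
infinity, so no boundary term survives. -/
theorem integral_rpow_mul_rpow_sub_one {a : ℝ} (ha : 1 < a) (ha' : a < 2) :
    ∫ x in Ioi (0 : ℝ), x ^ (-a) * ((1 + x) ^ (-a) - 1)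
      = a / (1 - a) * realBeta (2 - a) (2 * a - 1) := by
  obtain ⟨hB, hBv⟩ := integrableOn_and_integral_beta_halfLine (u := 2 - a) (v := 2 * a - 1)
    (by linarith) (by linarith)
  have hA := integrableOn_rpow_mul_rpow_sub_one ha ha'
  set F : ℝ → ℝ := fun x => x ^ (1 - a) * ((1 + x) ^ (-a) - 1) with hF
  have hder : ∀ x ∈ Ioi (0 : ℝ), HasDerivAt F
      ((1 - a) * (x ^ (-a) * ((1 + x) ^ (-a) - 1))
        - a * (x ^ (2 - a - 1) * (1 + x) ^ (-(2 - a) - (2 * a - 1)))) x := by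
    intro x hx
    have hx : 0 < x := hx
    have h1 := (hasDerivAt_id x).rpow_const (p := 1 - a) (Or.inl hx.ne')
    have h2 := (((hasDerivAt_id x).const_add 1).rpow_const (p := -a)
      (Or.inl (by simp only [id]; positivity))).sub_const 1
    convert! h1.mul h2 using 1
    simp only [id]
    rw [show 1 - a - 1 = -a by ring, show 2 - a - 1 = 1 - a by ring,
      show -(2 - a) - (2 * a - 1) = -a - 1 by ring]
    ring
  have hF0 : F 0 = 0 := by simp [hF]
  have hbd : ∀ x : ℝ, 0 < x → |F x| ≤ 2 * x ^ (2 - a) ∧ |F x| ≤ x ^ (1 - a) := by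
    intro x hx
    have hb := one_sub_rpow_neg_bounds (a := a) (by linarith) ha'.le hx.le
    have hp : 0 < (1 + x) ^ (-a) := by positivity
    rw [hF]
    simp only
    rw [abs_mul, abs_of_nonneg (by positivity : 0 ≤ x ^ (1 - a)), abs_sub_comm,
      abs_of_nonneg hb.1]
    constructor
    · have : x * (1 + x)⁻¹ ≤ x :=
        mul_le_of_le_one_right hx.le (inv_le_one_of_one_le₀ (by linarith))
      calc x ^ (1 - a) * (1 - (1 + x) ^ (-a)) ≤ x ^ (1 - a) * (2 * x) := by
            gcongr
            linarith
        _ = 2 * x ^ (2 - a) := by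
            rw [show 2 - a = 1 - a + 1 by ring, Real.rpow_add_one hx.ne']
            ring
    · exact mul_le_of_le_one_right (by positivity) (by linarith)
  have hcont : ContinuousWithinAt F (Ici 0) 0 := by
    rw [ContinuousWithinAt, hF0]
    refine squeeze_zero_norm' (a := fun x : ℝ => 2 * x ^ (2 - a)) ?_ ?_
    · filter_upwards [self_mem_nhdsWithin] with x hx
      rcases eq_or_lt_of_le (show (0 : ℝ) ≤ x from hx) with h | h
      · subst h
        rw [hF0, norm_zero]
        positivity
      · exact (hbd x h).1
    · have := ((Real.continuousAt_rpow_const 0 (2 - a) (Or.inr (by linarith))).const_mul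
        2).tendsto
      rw [Real.zero_rpow (by linarith), mul_zero] at this
      exact this.mono_left nhdsWithin_le_nhds
  have hinf : Tendsto F atTop (𝓝 0) := by
    refine squeeze_zero_norm' (a := fun x : ℝ => x ^ (1 - a)) ?_ ?_
    · filter_upwards [eventually_gt_atTop 0] with x hx using (hbd x hx).2
    · have := tendsto_rpow_neg_atTop (y := a - 1) (by linarith)
      simpa using this
  have hint := (hA.const_mul (1 - a)).sub (hB.const_mul a)
  have := integral_Ioi_of_hasDerivAt_of_tendsto hcont hder hint hinf
  rw [hF0, integral_sub (hA.const_mul (1 - a)) (hB.const_mul a), integral_const_mul,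
    integral_const_mul, hBv] at this
  rw [realBeta]
  have h1a : 1 - a ≠ 0 := by linarith
  rw [div_mul_eq_mul_div, eq_div_iff h1a]
  linarith

/-- The beta integrand x^(1-a) (1-x)^(1-a) dominates, since this amounts to (1-x)^(2-a) ≤ 1. -/
theorem integrableOn_rpow_mul_rpow_sub_one_unit {a : ℝ} (ha : 1 < a) (ha' : a < 2) :
    IntegrableOn (fun x : ℝ => x ^ (-a) * ((1 - x) ^ (1 - a) - 1)) (Ioo 0 1) := by
  have h := (integrableOn_and_integral_beta_unit (u := 2 - a) (v := 2 - a) (by linarith)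
    (by linarith)).1
  refine Integrable.mono' h (by
    refine Measurable.aestronglyMeasurable ?_
    fun_prop) ?_
  refine (ae_restrict_mem measurableSet_Ioo).mono fun x hx => ?_
  have h0 : 0 < 1 - x := by linarith [hx.2]
  have h1 : 1 ≤ (1 - x) ^ (1 - a) :=
    Real.one_le_rpow_of_pos_of_le_one_of_nonpos h0 (by linarith [hx.1]) (by linarith)
  have hx0 := hx.1
  rw [norm_mul, Real.norm_of_nonneg (by positivity), Real.norm_of_nonneg (by linarith)]
  have e1 : x ^ (2 - a - 1) = x ^ (-a) * x := by
    rw [show 2 - a - 1 = -a + 1 by ring, Real.rpow_add_one hx0.ne']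
  rw [e1, mul_assoc, show 2 - a - 1 = 1 - a by ring]
  gcongr
  have h2 : (1 - x) ^ (2 - a) ≤ 1 := Real.rpow_le_one h0.le (by linarith) (by linarith)
  rw [show 2 - a = (1 - a) + 1 by ring, Real.rpow_add_one h0.ne'] at h2
  linarith

/-- Integration by parts with F = x^(1-a) ((1-x)^(2-a) - 1). The value F(1) = -1 is the source of
the term -1/(1-a). -/
theorem integral_rpow_mul_rpow_sub_one_unit {a : ℝ} (ha : 1 < a) (ha' : a < 2) :
    ∫ x in Ioo (0 : ℝ) 1, x ^ (-a) * ((1 - x) ^ (1 - a) - 1)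
      = (3 - 2 * a) / (1 - a) * realBeta (2 - a) (2 - a) - 1 / (1 - a) := by
  obtain ⟨hB, hBv⟩ := integrableOn_and_integral_beta_unit (u := 2 - a) (v := 2 - a)
    (by linarith) (by linarith)
  have hM := integrableOn_rpow_mul_rpow_sub_one_unit ha ha'
  set F : ℝ → ℝ := fun x => x ^ (1 - a) * ((1 - x) ^ (2 - a) - 1) with hF
  have hder : ∀ x ∈ Ioo (0 : ℝ) 1, HasDerivAt F
      ((1 - a) * (x ^ (-a) * ((1 - x) ^ (1 - a) - 1))
        - (3 - 2 * a) * (x ^ (2 - a - 1) * (1 - x) ^ (2 - a - 1))) x := by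
    intro x hx
    have h0 : 0 < 1 - x := by linarith [hx.2]
    have h1 := (hasDerivAt_id x).rpow_const (p := 1 - a) (Or.inl hx.1.ne')
    have h2 := (((hasDerivAt_id x).const_sub 1).rpow_const (p := 2 - a)
      (Or.inl h0.ne')).sub_const 1
    convert! h1.mul h2 using 1
    simp only [id]
    rw [show 1 - a - 1 = -a by ring, show 2 - a - 1 = 1 - a by ring,
      show 2 - a = 1 - a + 1 by ring, Real.rpow_add_one h0.ne',
      show 1 - a = -a + 1 by ring, Real.rpow_add_one hx.1.ne']
    ring
  have hF0 : Tendsto F (𝓝[>] 0) (𝓝 0) := by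
    refine squeeze_zero_norm' (a := fun x : ℝ => x ^ (2 - a)) ?_ ?_
    · filter_upwards [Ioo_mem_nhdsGT (zero_lt_one' ℝ)] with x hx
      have h0 : 0 < 1 - x := by linarith [hx.2]
      have hx0 := hx.1
      have h2 : (1 - x) ^ (2 - a) ≤ 1 := Real.rpow_le_one h0.le (by linarith) (by linarith)
      have h3 : 1 - x ≤ (1 - x) ^ (2 - a) := by
        simpa using Real.rpow_le_rpow_of_exponent_ge h0 (by linarith) (by linarith : 2 - a ≤ 1)
      rw [hF]
      simp only
      rw [norm_mul, Real.norm_of_nonneg (by positivity), Real.norm_eq_abs, abs_sub_comm,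
        abs_of_nonneg (by linarith), show 2 - a = (1 - a) + 1 by ring,
        Real.rpow_add_one hx0.ne', ← show 2 - a = (1 - a) + 1 by ring]
      gcongr
      linarith
    · have := (Real.continuousAt_rpow_const 0 (2 - a) (Or.inr (by linarith))).tendsto
      rw [Real.zero_rpow (by linarith)] at this
      exact this.mono_left nhdsWithin_le_nhds
  have hF1 : Tendsto F (𝓝[<] 1) (𝓝 (-1)) := by
    have : ContinuousAt F 1 := by
      refine (Real.continuousAt_rpow_const _ _ (Or.inl one_ne_zero)).mul (ContinuousAt.sub ?_
        continuousAt_const)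
      exact ((Real.continuousAt_rpow_const _ _ (Or.inr (by linarith))).comp (by fun_prop))
    have h := this.tendsto
    have e : F 1 = -1 := by
      simp [hF, Real.zero_rpow (by linarith : 2 - a ≠ 0)]
    rw [e] at h
    exact h.mono_left nhdsWithin_le_nhds
  have hint := (hM.const_mul (1 - a)).sub (hB.const_mul (3 - 2 * a))
  have := intervalIntegral.integral_eq_sub_of_hasDerivAt_of_tendsto zero_lt_one hder
    ((intervalIntegrable_iff_integrableOn_Ioo_of_le zero_le_one).2 hint) hF0 hF1
  rw [intervalIntegral.integral_of_le zero_le_one, integral_Ioc_eq_integral_Ioo,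
    integral_sub (hM.const_mul (1 - a)) (hB.const_mul (3 - 2 * a)), integral_const_mul,
    integral_const_mul, hBv] at this
  rw [realBeta]
  have h1a : 1 - a ≠ 0 := by linarith
  rw [div_mul_eq_mul_div, ← sub_div, eq_div_iff h1a]
  linarith

/-- The regularized product of the two power functions centered at `0` and at `-1`. -/
def regProd (a x : ℝ) : ℝ := |x| ^ (-a) * |x + 1| ^ (-a) - |x| ^ (-a) - |x + 1| ^ (-a)

theorem regProd_reflect (a x : ℝ) : regProd a (-1 - x) = regProd a x := by
  have h1 : |-1 - x| = |x + 1| := by rw [← abs_neg]; congr 1; ring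
  have h2 : |-1 - x + 1| = |x| := by rw [← abs_neg]; congr 1; ring
  rw [regProd, regProd, h1, h2]
  ring

theorem integrableOn_integral_regProd_Ioi {a : ℝ} (ha : 1 < a) (ha' : a < 2) :
    IntegrableOn (regProd a) (Ioi 0) ∧ ∫ x in Ioi (0 : ℝ), regProd a x
      = a / (1 - a) * realBeta (2 - a) (2 * a - 1) - 1 / (a - 1) := by
  have h1 := integrableOn_rpow_mul_rpow_sub_one ha ha'
  have h2 : IntegrableOn (fun x : ℝ => (1 + x) ^ (-a)) (Ioi 0) := by
    have := integrableOn_add_rpow_Ioi_of_lt (a := -a) (m := 1) (c := 0) (by linarith)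
      (by norm_num)
    simpa only [add_comm] using this
  have h3 : ∫ x in Ioi (0 : ℝ), (1 + x) ^ (-a) = 1 / (a - 1) := by
    have := (integrableOn_and_integral_beta_halfLine (u := 1) (v := a - 1) (by norm_num)
      (by linarith)).2
    have e : (1 : ℝ) + (a - 1) = (a - 1) + 1 := by ring
    rw [Real.Gamma_one, e, Real.Gamma_add_one (by linarith), one_mul] at this
    have hg : Real.Gamma (a - 1) ≠ 0 := (Real.Gamma_pos_of_pos (by linarith)).ne'
    simp only [sub_self, Real.rpow_zero, one_mul] at this
    rw [show -1 - (a - 1) = -a by ring] at this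
    rw [this]
    have : a - 1 ≠ 0 := by linarith
    field_simp
  have key : EqOn (fun x : ℝ => x ^ (-a) * ((1 + x) ^ (-a) - 1) - (1 + x) ^ (-a)) (regProd a)
      (Ioi 0) := by
    intro x hx
    have hx : 0 < x := hx
    simp only [regProd]
    rw [abs_of_pos hx, abs_of_pos (by linarith), add_comm x 1]
    ring
  refine ⟨(integrableOn_congr_fun key measurableSet_Ioi).1 (h1.sub h2), ?_⟩
  rw [← setIntegral_congr_fun measurableSet_Ioi key, integral_sub h1 h2, h3,
    integral_rpow_mul_rpow_sub_one ha ha']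

/-- The line is cut at the two centers; the outer half lines are exchanged by the reflection x ↦
-1-x. The elementary constants 1/(a-1) from outside and inside cancel, as they must if pure powers
have continued integral zero. -/
theorem integrable_integral_regProd {a : ℝ} (ha : 1 < a) (ha' : a < 2) :
    Integrable (regProd a) ∧ ∫ x, regProd a x
      = 2 * (a / (1 - a) * realBeta (2 - a) (2 * a - 1))
        + 2 * ((3 - 2 * a) / (1 - a) * realBeta (2 - a) (2 - a)) := by
  obtain ⟨hp, hpv⟩ := integrableOn_integral_regProd_Ioi ha ha'
  have hq := integrableOn_rpow_mul_rpow_sub_one_unit ha ha'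
  have hqv := integral_rpow_mul_rpow_sub_one_unit ha ha'
  rw [← integrable_indicator_iff measurableSet_Ioi] at hp
  rw [← integrable_indicator_iff measurableSet_Ioo] at hq
  rw [← integral_indicator measurableSet_Ioi] at hpv
  rw [← integral_indicator measurableSet_Ioo] at hqv
  set p : ℝ → ℝ := indicator (Ioi 0) (regProd a) with hpdef
  set q : ℝ → ℝ := indicator (Ioo 0 1) (fun x : ℝ => x ^ (-a) * ((1 - x) ^ (1 - a) - 1))
    with hqdef
  have key : regProd a =ᵐ[volume] fun x => p x + p (-1 - x) + (q (-x) + q (x + 1)) := by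
    have hn : ∀ᵐ x : ℝ, x ∉ ({0, -1} : Set ℝ) :=
      (Set.Finite.countable (by simp)).ae_notMem volume
    filter_upwards [hn] with x hx
    simp only [mem_insert_iff, mem_singleton_iff, not_or] at hx
    rcases lt_or_gt_of_ne hx.1 with h0 | h0
    · rcases lt_or_gt_of_ne hx.2 with h1 | h1
      · have e1 : p x = 0 := indicator_of_notMem (by simp [h0.le]) _
        have e2 : p (-1 - x) = regProd a (-1 - x) := indicator_of_mem (by simp; linarith) _
        have e3 : q (-x) = 0 := indicator_of_notMem (by
          simp only [mem_Ioo, not_and, not_lt]; intro; linarith) _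
        have e4 : q (x + 1) = 0 := indicator_of_notMem (by
          simp only [mem_Ioo, not_and, not_lt]; intro; linarith) _
        rw [e1, e2, e3, e4, regProd_reflect]
        ring
      · have e1 : p x = 0 := indicator_of_notMem (by simp [h0.le]) _
        have e2 : p (-1 - x) = 0 := indicator_of_notMem (by simp; linarith) _
        have e3 : q (-x) = (-x) ^ (-a) * ((1 - -x) ^ (1 - a) - 1) :=
          indicator_of_mem (by constructor <;> linarith) _
        have e4 : q (x + 1) = (x + 1) ^ (-a) * ((1 - (x + 1)) ^ (1 - a) - 1) :=
          indicator_of_mem (by constructor <;> linarith) _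
        have hy : 0 < -x := by linarith
        have hz : 0 < x + 1 := by linarith
        -- With y = -x and z = x+1, the relation y + z = 1 gives y^(-a) z^(-a) = y^(-a) z^(1-a) +
        -- y^(1-a) z^(-a), which separates the two singularities.
        rw [e1, e2, e3, e4, regProd, abs_of_neg h0, abs_of_pos hz, sub_neg_eq_add, add_comm 1 x,
          show 1 - (x + 1) = -x by ring, show 1 - a = -a + 1 by ring,
          Real.rpow_add_one hy.ne', Real.rpow_add_one hz.ne']
        ring
    · have e1 : p x = regProd a x := indicator_of_mem h0 _
      have e2 : p (-1 - x) = 0 := indicator_of_notMem (by simp; linarith) _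
      have e3 : q (-x) = 0 := indicator_of_notMem (by
        simp only [mem_Ioo, not_and, not_lt]; intro; linarith) _
      have e4 : q (x + 1) = 0 := indicator_of_notMem (by
        simp only [mem_Ioo, not_and, not_lt]; intro; linarith) _
      rw [e1, e2, e3, e4]
      ring
  have i2 := hp.comp_sub_left (-1)
  have i3 := hq.comp_neg
  have i4 := hq.comp_add_right 1
  refine ⟨((hp.add i2).add (i3.add i4)).congr key.symm, ?_⟩
  have e1 : ∫ x, (p x + p (-1 - x) + (q (-x) + q (x + 1)))
      = (∫ x, (p x + p (-1 - x))) + ∫ x, (q (-x) + q (x + 1)) :=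
    integral_add (hp.add i2) (i3.add i4)
  rw [integral_congr_ae key, e1, integral_add hp i2, integral_add i3 i4,
    integral_neg_eq_self q, integral_add_right_eq_self q, integral_sub_left_eq_self p, hpv, hqv]
  have : 1 / (a - 1) = - (1 / (1 - a)) := by
    rw [← neg_sub, one_div_neg_eq_neg_one_div]
  rw [this]
  ring

/-- In terms of the Euler beta function, continued analytically by the recursion of `Γ`. -/
theorem ofReal_integral_regProd {a : ℝ} (ha : 1 < a) (ha' : a < 2) :
    ((∫ x, regProd a x : ℝ) : ℂ)
      = 2 * beta (1 - a) (2 * a - 1) + beta (1 - a) (1 - a) := by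
  rw [(integrable_integral_regProd ha ha').2]
  have h1a : (1 : ℂ) - a ≠ 0 := by
    rw [← Complex.ofReal_one, ← Complex.ofReal_sub, Complex.ofReal_ne_zero]
    linarith
  have ha0 : (a : ℂ) ≠ 0 := by
    rw [Complex.ofReal_ne_zero]
    linarith
  have g1 : Complex.Gamma (2 - a) = (1 - a) * Complex.Gamma (1 - a) := by
    rw [← Complex.Gamma_add_one _ h1a]
    congr 1
    ring
  have g2 : Complex.Gamma (2 - a + (2 * a - 1)) = a * Complex.Gamma (1 - a + (2 * a - 1)) := by
    rw [show (1 : ℂ) - a + (2 * a - 1) = a by ring, ← Complex.Gamma_add_one _ ha0]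
    congr 1
    ring
  -- The recursion is used for 1/Γ because Γ(2-2a) has a pole at a = 3/2.
  have g3 : (Complex.Gamma (1 - a + (1 - a)))⁻¹
      = (1 - a + (1 - a)) * (3 - 2 * a) * (Complex.Gamma (2 - a + (2 - a)))⁻¹ := by
    rw [Complex.one_div_Gamma_eq_self_mul_one_div_Gamma_add_one (1 - a + (1 - a)),
      Complex.one_div_Gamma_eq_self_mul_one_div_Gamma_add_one (1 - a + (1 - a) + 1),
      show (1 : ℂ) - a + (1 - a) + 1 = 3 - 2 * a by ring,
      show (3 : ℂ) - 2 * a + 1 = 2 - a + (2 - a) by ring]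
    ring
  have hga : Complex.Gamma (1 - a + (2 * a - 1)) ≠ 0 := by
    rw [show (1 : ℂ) - a + (2 * a - 1) = a by ring]
    exact Complex.Gamma_ne_zero_of_re_pos (by simp; linarith)
  rw [beta, beta, div_eq_mul_inv (_ * _) (Complex.Gamma (1 - a + (1 - a))), g3]
  simp only [realBeta]
  push_cast [← Complex.Gamma_ofReal]
  rw [g1, g2]
  field_simp
  ring

/-! ### Lattice sums and unfolding of the integral -/

/-- The sum of `|x + n| ^ (-a)` over the integers (a vanishing base contributes `0`). -/
def latticeSum (a x : ℝ) : ℝ := ∑' n : ℤ, |x + n| ^ (-a)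

theorem summable_abs_add_int_rpow {a : ℝ} (ha : 1 < a) (x : ℝ) :
    Summable fun n : ℤ => |x + n| ^ (-a) := by
  refine ((Real.summable_one_div_int_add_rpow x a).2 ha).congr fun n => ?_
  rw [Real.rpow_neg (abs_nonneg _), one_div, add_comm]

theorem hasSum_latticeSum {a : ℝ} (ha : 1 < a) (x : ℝ) :
    HasSum (fun n : ℤ => |x + n| ^ (-a)) (latticeSum a x) :=
  (summable_abs_add_int_rpow ha x).hasSum

theorem hasSum_latticeSum_zero {a : ℝ} (ha : 1 < a) :
    HasSum (fun n : ℤ => |(n : ℝ)| ^ (-a)) (latticeSum a 0) := by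
  simpa using hasSum_latticeSum ha 0

/-- Integrating an absolutely convergent double sum of integer translates over a period. -/
theorem integral_tsum_translates {f : ℤ → ℝ → ℝ} (hf : ∀ k, Integrable (f k))
    (hs : Summable fun k => ∫ x, ‖f k x‖) :
    ∫ x in Ioo (0 : ℝ) 1, ∑' p : ℤ × ℤ, f p.1 (x + p.2) = ∑' k, ∫ x, f k x := by
  have conv : ∀ g : ℝ → ℝ, ∫ x in (0 : ℝ)..1, g x = ∫ x in Ioo (0 : ℝ) 1, g x := fun g => by
    rw [intervalIntegral.integral_of_le zero_le_one, integral_Ioc_eq_integral_Ioo]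
  have hn : ∀ k, HasSum (fun n : ℤ => ∫ x in Ioo (0 : ℝ) 1, ‖f k (x + n)‖) (∫ x, ‖f k x‖) := by
    intro k
    simpa only [conv] using (hf k).norm.hasSum_intervalIntegral_comp_add_int
  have h1 : ∀ k, HasSum (fun n : ℤ => ∫ x in Ioo (0 : ℝ) 1, f k (x + n)) (∫ x, f k x) := by
    intro k
    simpa only [conv] using (hf k).hasSum_intervalIntegral_comp_add_int
  have hsum : Summable fun p : ℤ × ℤ => ∫ x in Ioo (0 : ℝ) 1, ‖f p.1 (x + p.2)‖ := by
    rw [summable_prod_of_nonneg (fun p => integral_nonneg fun x => norm_nonneg _)]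
    refine ⟨fun k => (hn k).summable, ?_⟩
    simpa only [(hn _).tsum_eq] using hs
  have hint : ∀ p : ℤ × ℤ, Integrable (fun x => f p.1 (x + p.2))
      (volume.restrict (Ioo (0 : ℝ) 1)) := fun p => ((hf p.1).comp_add_right _).restrict
  have h2 := hasSum_integral_of_summable_integral_norm hint hsum
  rw [← h2.tsum_eq]
  have h3 := h2.summable.tsum_prod' (fun k => (h1 k).summable)
  rw [h3]
  exact tsum_congr fun k => (h1 k).tsum_eq

/-- The product of the powers centered at `0` and `-k`, regularized at both centers; for `k = 0`
the square of the power, cut off in the unit interval. -/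
def cellTerm (a : ℝ) (k : ℤ) (x : ℝ) : ℝ :=
  if k = 0 then indicator (Ici 1) (fun y : ℝ => y ^ (-2 * a)) |x|
  else |x| ^ (-a) * |x + k| ^ (-a) - |(k : ℝ)| ^ (-a) * |x| ^ (-a)
    - |(k : ℝ)| ^ (-a) * |x + k| ^ (-a)

/-- Homogeneity under x = k y; negative k is covered because only absolute values occur. -/
theorem cellTerm_eq_scaled (a : ℝ) {k : ℤ} (hk : k ≠ 0) (x : ℝ) :
    cellTerm a k x = |(k : ℝ)| ^ (-2 * a) * regProd a ((k : ℝ)⁻¹ * x) := by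
  have hk' : (k : ℝ) ≠ 0 := by exact_mod_cast hk
  have hk0 : 0 < |(k : ℝ)| := abs_pos.2 hk'
  have e1 : |x| ^ (-a) = |(k : ℝ)| ^ (-a) * |(k : ℝ)⁻¹ * x| ^ (-a) := by
    rw [← Real.mul_rpow (abs_nonneg _) (abs_nonneg _), ← abs_mul, mul_inv_cancel_left₀ hk']
  have e2 : |x + k| ^ (-a) = |(k : ℝ)| ^ (-a) * |(k : ℝ)⁻¹ * x + 1| ^ (-a) := by
    rw [← Real.mul_rpow (abs_nonneg _) (abs_nonneg _), ← abs_mul]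
    congr 2
    field_simp
  have e3 : |(k : ℝ)| ^ (-2 * a) = |(k : ℝ)| ^ (-a) * |(k : ℝ)| ^ (-a) := by
    rw [← Real.rpow_add hk0]
    congr 1
    ring
  rw [cellTerm, if_neg hk, e1, e2, e3, regProd]
  ring

theorem integrable_integral_cellTerm {a : ℝ} (ha : 1 < a) (ha' : a < 2) {k : ℤ} (hk : k ≠ 0) :
    Integrable (cellTerm a k)
      ∧ ∫ x, cellTerm a k x = |(k : ℝ)| ^ (-(2 * a - 1)) * ∫ x, regProd a x
      ∧ ∫ x, ‖cellTerm a k x‖ = |(k : ℝ)| ^ (-(2 * a - 1)) * ∫ x, ‖regProd a x‖ := by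
  have hk' : (k : ℝ) ≠ 0 := by exact_mod_cast hk
  have hk0 : 0 < |(k : ℝ)| := abs_pos.2 hk'
  have hr := (integrable_integral_regProd ha ha').1
  have he : |(k : ℝ)| ^ (-(2 * a - 1)) = |(k : ℝ)| ^ (-2 * a) * |(k : ℝ)| := by
    rw [← Real.rpow_add_one hk0.ne']
    congr 1
    ring
  have hfun : cellTerm a k = fun x => |(k : ℝ)| ^ (-2 * a) * regProd a ((k : ℝ)⁻¹ * x) :=
    funext (cellTerm_eq_scaled a hk)
  rw [hfun, he]
  refine ⟨(hr.comp_mul_left' (inv_ne_zero hk')).const_mul _, ?_, ?_⟩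
  · rw [integral_const_mul, Measure.integral_comp_inv_mul_left (regProd a), smul_eq_mul]
    ring
  · simp_rw [norm_mul]
    rw [integral_const_mul, Measure.integral_comp_inv_mul_left (fun x => ‖regProd a x‖),
      smul_eq_mul, Real.norm_of_nonneg (by positivity)]
    ring

theorem integrable_integral_cellTerm_zero {a : ℝ} (ha : 1 < a) :
    Integrable (cellTerm a 0) ∧ ∫ x, cellTerm a 0 x = 2 / (2 * a - 1) := by
  set g : ℝ → ℝ := indicator (Ici 1) (fun y : ℝ => y ^ (-2 * a)) with hg
  have h1 : Integrable g := by
    rw [hg, integrable_indicator_iff measurableSet_Ici, integrableOn_Ici_iff_integrableOn_Ioi]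
    exact integrableOn_Ioi_rpow_of_lt (by linarith) one_pos
  have h2 : ∫ y, g y = 1 / (2 * a - 1) := by
    rw [hg, integral_indicator measurableSet_Ici, integral_Ici_eq_integral_Ioi,
      integral_Ioi_rpow_of_lt (by linarith) one_pos, Real.one_rpow, ← neg_div_neg_eq]
    congr 1 <;> ring
  have hout : ∀ y : ℝ, y < 1 → g y = 0 := fun y hy => indicator_of_notMem (by simpa using hy) _
  have hfun : cellTerm a 0 = fun x => g x + g (-x) := by
    funext x
    rw [cellTerm, if_pos rfl]
    rcases le_total 0 x with h | h
    · rw [abs_of_nonneg h, hout (-x) (by linarith), add_zero]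
    · rw [abs_of_nonpos h, hout x (by linarith), zero_add]
  rw [hfun]
  refine ⟨h1.add h1.comp_neg, ?_⟩
  rw [integral_add h1 h1.comp_neg, integral_neg_eq_self g, h2]
  ring

/-- The real integrand of `K`. -/
def kern (a x : ℝ) : ℝ :=
  (latticeSum a 0 - latticeSum a x) ^ 2 - x ^ (-2 * a) - (1 - x) ^ (-2 * a)

/-- The square S(x)² and the two copies of S(0) S(x) are double sums, reindexed so that k is always
the difference of the two centers. -/
theorem hasSum_cellTerm {a : ℝ} (ha : 1 < a) {x : ℝ} (hx : x ∈ Ioo (0 : ℝ) 1) :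
    HasSum (fun p : ℤ × ℤ => cellTerm a p.1 (x + p.2)) (kern a x - latticeSum a 0 ^ 2) := by
  have hS := hasSum_latticeSum ha x
  have hW := hasSum_latticeSum_zero ha
  have nn : ∀ y : ℝ, 0 ≤ |y| ^ (-a) := fun y => Real.rpow_nonneg (abs_nonneg _) _
  have hSS := hS.mul hS (hS.summable.mul_of_nonneg hS.summable (fun n => nn _) (fun n => nn _))
  have hWS := hW.mul hS (hW.summable.mul_of_nonneg hS.summable (fun n => nn _) (fun n => nn _))
  let e₁ : ℤ × ℤ ≃ ℤ × ℤ :=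
    { toFun := fun p => (p.2, p.2 + p.1)
      invFun := fun p => (p.2 - p.1, p.1)
      left_inv := fun p => by ext <;> simp
      right_inv := fun p => by ext <;> simp }
  let e₂ : ℤ × ℤ ≃ ℤ × ℤ :=
    { toFun := fun p => (p.1, p.2 + p.1)
      invFun := fun p => (p.1, p.2 - p.1)
      left_inv := fun p => by ext <;> simp
      right_inv := fun p => by ext <;> simp }
  have hSS' := (e₁.hasSum_iff).2 hSS
  have hWS' := (e₂.hasSum_iff).2 hWS
  -- The pairs with k = 0 and n = 0 or -1 are the only ones with |x+n| < 1. The subtracted x^(-2a)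
  -- and (1-x)^(-2a) cancel them, which is the cutoff in `cellTerm a 0`.
  have h0 := hasSum_ite_eq ((0, 0) : ℤ × ℤ) (x ^ (-2 * a))
  have h1 := hasSum_ite_eq ((0, -1) : ℤ × ℤ) ((1 - x) ^ (-2 * a))
  have hx0 := hx.1
  have hx1 : 0 < 1 - x := by linarith [hx.2]
  have sq : ∀ y : ℝ, 0 < y → y ^ (-2 * a) = y ^ (-a) * y ^ (-a) := fun y hy => by
    rw [← Real.rpow_add hy]
    congr 1
    ring
  have tot := (((hSS'.sub hWS).sub hWS').sub h0).sub h1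
  convert! tot using 1
  · funext ⟨k, n⟩
    simp only [Function.comp, e₁, e₂, Equiv.coe_fn_mk, Prod.mk.injEq]
    rcases eq_or_ne k 0 with rfl | hk
    · have hz : |((0 : ℤ) : ℝ)| ^ (-a) = 0 := by
        rw [Int.cast_zero, abs_zero, Real.zero_rpow (by linarith)]
      rw [cellTerm, if_pos rfl, hz]
      simp only [true_and, zero_mul, sub_zero, add_zero]
      rcases eq_or_ne n 0 with rfl | hn0
      · rw [indicator_of_notMem (by simp [abs_of_pos hx0, hx.2])]
        simp only [Int.cast_zero, add_zero, abs_of_pos hx0, sq x hx0]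
        simp
      rcases eq_or_ne n (-1) with rfl | hn1
      · have e : |x + ((-1 : ℤ) : ℝ)| = 1 - x := by
          rw [← abs_of_pos hx1, ← abs_neg]
          push_cast
          congr 1
          ring
        rw [e, indicator_of_notMem (by simp [hx0]), sq _ hx1]
        simp
      · have hmem : |x + (n : ℝ)| ∈ Ici (1 : ℝ) := by
          rw [mem_Ici]
          rcases lt_or_gt_of_ne hn0 with h | h
          · have : n ≤ -2 := by omega
            have : (n : ℝ) ≤ -2 := by exact_mod_cast this
            rw [abs_of_neg (by linarith [hx.2])]
            linarith [hx.2]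
          · have : (1 : ℝ) ≤ n := by exact_mod_cast h
            rw [abs_of_pos (by linarith)]
            linarith
        rw [indicator_of_mem hmem, if_neg hn0, if_neg hn1,
          sq _ (lt_of_lt_of_le one_pos hmem)]
        ring
    · rw [cellTerm, if_neg hk]
      simp only [hk, false_and, if_false, sub_zero]
      push_cast
      rw [add_assoc]
  · rw [kern]
    ring

/-- The integral of the regularized square, evaluated by summing over the cells. -/
theorem integral_kern {a : ℝ} (ha : 1 < a) (ha' : a < 2) (hk : IntegrableOn (kern a) (Ioo 0 1)) :
    ∫ x in Ioo (0 : ℝ) 1, kern a x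
      = latticeSum a 0 ^ 2 + latticeSum (2 * a - 1) 0 * (∫ x, regProd a x) + 2 / (2 * a - 1) := by
  obtain ⟨h0i, h0v⟩ := integrable_integral_cellTerm_zero ha
  have hi : ∀ k, Integrable (cellTerm a k) := fun k => by
    rcases eq_or_ne k 0 with rfl | hk
    · exact h0i
    · exact (integrable_integral_cellTerm ha ha' hk).1
  have hW := hasSum_latticeSum_zero (a := 2 * a - 1) (by linarith)
  -- The zero base makes the k = 0 term of the lattice sum vanish, so the k = 0 cell is added
  -- separately.
  have hz : |((0 : ℤ) : ℝ)| ^ (-(2 * a - 1)) = 0 := by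
    rw [Int.cast_zero, abs_zero, Real.zero_rpow (by linarith)]
  have hs : Summable fun k => ∫ x, ‖cellTerm a k x‖ := by
    have := (hW.mul_right (∫ x, ‖regProd a x‖)).summable.add
      (hasSum_ite_eq (0 : ℤ) (∫ x, ‖cellTerm a 0 x‖)).summable
    refine this.congr fun k => ?_
    rcases eq_or_ne k 0 with rfl | hk
    · rw [hz]
      simp
    · rw [if_neg hk, (integrable_integral_cellTerm ha ha' hk).2.2, add_zero]
  have hv : HasSum (fun k => ∫ x, cellTerm a k x)
      (latticeSum (2 * a - 1) 0 * (∫ x, regProd a x) + 2 / (2 * a - 1)) := by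
    have := (hW.mul_right (∫ x, regProd a x)).add (hasSum_ite_eq (0 : ℤ) (2 / (2 * a - 1)))
    convert! this using 1
    funext k
    rcases eq_or_ne k 0 with rfl | hk
    · rw [hz, h0v]
      simp
    · rw [if_neg hk, (integrable_integral_cellTerm ha ha' hk).2.1, add_zero]
  have key := integral_tsum_translates hi hs
  rw [hv.tsum_eq, setIntegral_congr_fun measurableSet_Ioo
    (fun x hx => (hasSum_cellTerm ha hx).tsum_eq)] at key
  have hc : IntegrableOn (fun _ : ℝ => latticeSum a 0 ^ 2) (Ioo (0 : ℝ) 1) := by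
    simp [integrableOn_const_iff]
  have h4 := integral_sub hk hc
  rw [h4] at key
  simp at key
  linarith

/-! ### Bounds uniform in the exponent and the limit a → 2 -/

/-- Lower bound: the product (1-u²)^(-a) is at least 1, so the sum is at least 2 by the inequality
of the means. Upper bound: Bernoulli with exponent a/2 ≤ 1 applied to t^(-2) reduces to the case a =
2, where 6u²/(1-u²)² ≤ (32/3)u² for |u| ≤ 1/2. -/
theorem second_difference_rpow_bounds {a u : ℝ} (ha : 0 ≤ a) (ha' : a ≤ 2) (hu : |u| ≤ 1 / 2) :
    |(1 + u) ^ (-a) + (1 - u) ^ (-a) - 2| ≤ 11 * u ^ 2 := by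
  obtain ⟨hu1, hu2⟩ := abs_le.1 hu
  have hp : 0 < 1 + u := by linarith
  have hq : 0 < 1 - u := by linarith
  have bern : ∀ t : ℝ, 0 < t → t ^ (-a) ≤ 1 + a / 2 * ((t ^ 2)⁻¹ - 1) := by
    intro t ht
    have h := rpow_one_add_le_one_add_mul_self (s := (t ^ 2)⁻¹ - 1) (p := a / 2)
      (by have : 0 < (t ^ 2)⁻¹ := by positivity
          linarith) (by linarith) (by linarith)
    rw [add_sub_cancel, Real.inv_rpow (by positivity), ← Real.rpow_natCast,
      ← Real.rpow_mul ht.le, ← Real.rpow_neg ht.le] at h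
    convert! h using 2
    · push_cast
      ring
    · norm_cast
  have hsq : u ^ 2 ≤ 1 / 4 := by nlinarith
  have hnn := sq_nonneg u
  have id2 : ((1 + u) ^ 2)⁻¹ - 1 + (((1 - u) ^ 2)⁻¹ - 1)
      = (6 * u ^ 2 - 2 * u ^ 4) / (1 - u ^ 2) ^ 2 := by
    have h3 : 1 - u ^ 2 ≠ 0 := by nlinarith
    have h4 : 1 - u ^ 2 = (1 + u) * (1 - u) := by ring
    rw [h4]
    field_simp
    ring
  have h0 : 0 ≤ (6 * u ^ 2 - 2 * u ^ 4) / (1 - u ^ 2) ^ 2 := by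
    apply div_nonneg _ (by positivity)
    nlinarith
  have h1 : (6 * u ^ 2 - 2 * u ^ 4) / (1 - u ^ 2) ^ 2 ≤ 11 * u ^ 2 := by
    have : 0 < 1 - u ^ 2 := by nlinarith
    rw [div_le_iff₀ (by positivity)]
    have h5 : 9 / 16 ≤ (1 - u ^ 2) ^ 2 := by nlinarith
    nlinarith [mul_le_mul_of_nonneg_left h5 hnn]
  rw [abs_le]
  constructor
  · have hpp : 0 < (1 + u) ^ (-a) := by positivity
    have hqq : 0 < (1 - u) ^ (-a) := by positivity
    have hpq : 1 ≤ (1 + u) ^ (-a) * (1 - u) ^ (-a) := by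
      rw [← Real.mul_rpow hp.le hq.le]
      exact Real.one_le_rpow_of_pos_of_le_one_of_nonpos (by positivity) (by nlinarith)
        (by linarith)
    nlinarith [sq_nonneg ((1 + u) ^ (-a) - (1 - u) ^ (-a))]
  · have hsum := add_le_add (bern _ hp) (bern _ hq)
    have : a / 2 * (((1 + u) ^ 2)⁻¹ - 1) + a / 2 * (((1 - u) ^ 2)⁻¹ - 1) ≤ 11 * u ^ 2 := by
      rw [← mul_add, id2]
      nlinarith
    linarith

theorem latticeSum_neg {a : ℝ} (x : ℝ) : latticeSum a (-x) = latticeSum a x := by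
  rw [latticeSum, latticeSum, ← (Equiv.neg ℤ).tsum_eq]
  refine tsum_congr fun n => ?_
  rw [← abs_neg]
  congr 2
  simp
  ring

theorem latticeSum_one_sub {a : ℝ} (x : ℝ) : latticeSum a (1 - x) = latticeSum a x := by
  rw [← latticeSum_neg, neg_sub, latticeSum, latticeSum, ← (Equiv.addRight (1 : ℤ)).tsum_eq]
  refine tsum_congr fun n => ?_
  rw [Equiv.coe_addRight]
  push_cast
  congr 2
  ring

/-- Averaging the sum with its reflection n ↦ -n leaves half a second difference for each n ≠ 0, so
the linear term drops out. The order x² is what offsets x^(-a) up to a = 2. The constant 6 is 11/2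
rounded up. -/
theorem abs_latticeSum_sub_add_le {a x : ℝ} (ha : 1 < a) (ha' : a ≤ 2) (hx : 0 < x)
    (hx' : x ≤ 1 / 2) :
    |latticeSum a 0 - latticeSum a x + x ^ (-a)| ≤ 6 * latticeSum 2 0 * x ^ 2 := by
  have hS := hasSum_latticeSum ha x
  have hS' : HasSum (fun n : ℤ => |(n : ℝ) - x| ^ (-a)) (latticeSum a x) := by
    have := hasSum_latticeSum ha (-x)
    rw [latticeSum_neg] at this
    convert! this using 4
    ring
  have hW := hasSum_latticeSum_zero ha
  have htot := (hW.sub ((hS.add hS').div_const 2)).add (hasSum_ite_eq (0 : ℤ) (x ^ (-a)))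
  rw [add_self_div_two] at htot
  have hb := (hasSum_latticeSum_zero (a := 2) (by norm_num)).mul_left (6 * x ^ 2)
  rw [show 6 * latticeSum 2 0 * x ^ 2 = 6 * x ^ 2 * latticeSum 2 0 by ring, ← Real.norm_eq_abs]
  refine htot.norm_le_of_bounded hb fun n => ?_
  rcases eq_or_ne n 0 with rfl | hn
  · have : |x| ^ (-a) = x ^ (-a) := by rw [abs_of_pos hx]
    simp only [Int.cast_zero, add_zero, zero_sub, abs_neg, this, abs_zero, if_pos]
    rw [Real.zero_rpow (by linarith), Real.zero_rpow (by norm_num), add_self_div_two]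
    simp
  · rw [if_neg hn, add_zero]
    have hn' : (n : ℝ) ≠ 0 := by exact_mod_cast hn
    have hn1 : 1 ≤ |(n : ℝ)| := by
      rw [← Int.cast_abs]
      exact_mod_cast Int.one_le_abs hn
    have hn0 : 0 < |(n : ℝ)| := by linarith
    have hu : |x / n| ≤ 1 / 2 := by
      rw [abs_div, abs_of_pos hx]
      exact (div_le_self hx.le hn1).trans hx'
    obtain ⟨hu1, hu2⟩ := abs_le.1 hu
    have hd := second_difference_rpow_bounds (a := a) (by linarith) ha' hu
    have e1 : |x + n| ^ (-a) = |(n : ℝ)| ^ (-a) * (1 + x / n) ^ (-a) := by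
      rw [← Real.mul_rpow (abs_nonneg _) (by linarith),
        ← abs_of_nonneg (by linarith : 0 ≤ 1 + x / n), ← abs_mul]
      congr 2
      field_simp
      ring
    have e2 : |n - x| ^ (-a) = |(n : ℝ)| ^ (-a) * (1 - x / n) ^ (-a) := by
      rw [← Real.mul_rpow (abs_nonneg _) (by linarith),
        ← abs_of_nonneg (by linarith : 0 ≤ 1 - x / n), ← abs_mul]
      congr 2
      field_simp
    have e3 : |(n : ℝ)| ^ (-a) - (|x + n| ^ (-a) + |n - x| ^ (-a)) / 2
        = -(|(n : ℝ)| ^ (-a) * ((1 + x / n) ^ (-a) + (1 - x / n) ^ (-a) - 2) / 2) := by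
      rw [e1, e2]
      ring
    have e4 : |(n : ℝ)| ^ (-a) ≤ 1 := Real.rpow_le_one_of_one_le_of_nonpos hn1 (by linarith)
    have e5 : (x / n) ^ 2 = x ^ 2 * |(n : ℝ)| ^ (-(2 : ℝ)) := by
      rw [Real.rpow_neg (abs_nonneg _), Real.rpow_two, sq_abs]
      field_simp
    rw [e3, norm_neg, norm_div, norm_mul, Real.norm_of_nonneg (by positivity), Real.norm_eq_abs,
      Real.norm_eq_abs]
    have e6 := mul_le_mul e4 hd (abs_nonneg _) zero_le_one
    rw [e5] at e6
    have : 0 ≤ x ^ 2 * |(n : ℝ)| ^ (-(2 : ℝ)) := by positivity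
    rw [abs_two]
    linarith

theorem latticeSum_zero_nonneg (a : ℝ) : 0 ≤ latticeSum a 0 :=
  tsum_nonneg fun _ => Real.rpow_nonneg (abs_nonneg _) _

theorem kern_one_sub (a x : ℝ) : kern a (1 - x) = kern a x := by
  rw [kern, kern, latticeSum_one_sub, sub_sub_cancel]
  ring

/-- A bound for the integrand that is uniform in the exponent. -/
theorem abs_kern_le {a x : ℝ} (ha : 1 < a) (ha' : a ≤ 2) (hx : x ∈ Ioo (0 : ℝ) 1) :
    |kern a x| ≤ (6 * latticeSum 2 0) ^ 2 + 2 * (6 * latticeSum 2 0) + 16 := by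
  wlog hx' : x ≤ 1 / 2 generalizing x
  · rw [← kern_one_sub]
    exact this ⟨by linarith [hx.2], by linarith [hx.1]⟩ (by linarith)
  set C := 6 * latticeSum 2 0 with hC
  have hC0 : 0 ≤ C := by
    have := latticeSum_zero_nonneg 2
    positivity
  have hx0 := hx.1
  have hh := abs_latticeSum_sub_add_le ha ha' hx0 hx'
  set h := latticeSum a 0 - latticeSum a x + x ^ (-a) with hdef
  -- Writing S(0) - S(x) = h - x^(-a) cancels the singular x^(-2a), and the cross term h x^(-a) is
  -- bounded because h = O(x²).
  have e1 : kern a x = h ^ 2 - 2 * (h * x ^ (-a)) - (1 - x) ^ (-2 * a) := by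
    have : x ^ (-2 * a) = x ^ (-a) * x ^ (-a) := by
      rw [← Real.rpow_add hx0]
      congr 1
      ring
    rw [kern, this, hdef]
    ring
  have e2 : |h| ≤ C := hh.trans (mul_le_of_le_one_right hC0 (by nlinarith))
  have e3 : |h * x ^ (-a)| ≤ C := by
    rw [abs_mul, abs_of_nonneg (a := x ^ (-a)) (by positivity)]
    calc |h| * x ^ (-a) ≤ C * x ^ 2 * x ^ (-a) := by gcongr
      _ = C * x ^ (2 - a) := by
        rw [mul_assoc, ← Real.rpow_two, ← Real.rpow_add hx0]
        rfl
      _ ≤ C * 1 := by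
        gcongr
        exact Real.rpow_le_one hx0.le (by linarith) (by linarith)
      _ = C := mul_one C
  have e4 : 0 ≤ (1 - x) ^ (-2 * a) := Real.rpow_nonneg (by linarith) _
  have e5 : (1 - x) ^ (-2 * a) ≤ 16 := by
    calc (1 - x) ^ (-2 * a) ≤ (1 / 2 : ℝ) ^ (-2 * a) :=
          Real.rpow_le_rpow_of_nonpos (by norm_num) (by linarith) (by linarith)
      _ ≤ (1 / 2 : ℝ) ^ (-4 : ℝ) :=
          Real.rpow_le_rpow_of_exponent_ge (by norm_num) (by norm_num) (by linarith)
      _ = 16 := by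
          rw [show (-4 : ℝ) = ((-4 : ℤ) : ℝ) by norm_num, Real.rpow_intCast]
          norm_num
  have e6 : h ^ 2 ≤ C ^ 2 := sq_le_sq' (by linarith [neg_abs_le h]) (by linarith [le_abs_self h])
  have e7 := sq_nonneg h
  obtain ⟨e8, e9⟩ := abs_le.1 e3
  rw [e1, abs_le]
  have := sq_nonneg C
  constructor <;> linarith

theorem measurable_kern {a : ℝ} : Measurable (kern a) := by
  have : Measurable (latticeSum a) := by
    unfold latticeSum
    exact Measurable.tsum fun n => by fun_prop
  unfold kern
  fun_prop

theorem integrableOn_kern {a : ℝ} (ha : 1 < a) (ha' : a ≤ 2) :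
    IntegrableOn (kern a) (Ioo 0 1) := by
  refine Measure.integrableOn_of_bounded 
    (M := (6 * latticeSum 2 0) ^ 2 + 2 * (6 * latticeSum 2 0) + 16) (by simp)
    measurable_kern.aestronglyMeasurable ?_
  exact (ae_restrict_mem measurableSet_Ioo).mono fun x hx => abs_kern_le ha ha' hx

theorem tendsto_latticeSum (x : ℝ) :
    Tendsto (fun a => latticeSum a x) (𝓝[<] 2) (𝓝 (latticeSum 2 x)) := by
  refine tendsto_tsum_of_dominated_convergence
    (bound := fun n : ℤ => |x + n| ^ (-(3 / 2 : ℝ)) + |x + n| ^ (-(2 : ℝ))) ?_ ?_ ?_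
  · exact (summable_abs_add_int_rpow (by norm_num) x).add
      (summable_abs_add_int_rpow (by norm_num) x)
  · intro n
    refine Tendsto.mono_left ?_ nhdsWithin_le_nhds
    rcases eq_or_ne (|x + n|) 0 with h | h
    · rw [h]
      refine Tendsto.congr' ?_ tendsto_const_nhds
      filter_upwards [lt_mem_nhds (show (0 : ℝ) < 2 by norm_num)] with a ha
      rw [Real.zero_rpow (by norm_num), Real.zero_rpow (by linarith)]
    · exact ((Real.continuousAt_const_rpow h).comp continuousAt_neg).tendsto
  · filter_upwards [Ioo_mem_nhdsLT (show (3 / 2 : ℝ) < 2 by norm_num)] with a ha n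
    have h1 : 0 ≤ |x + n| ^ (-(3 / 2 : ℝ)) := by positivity
    have h2 : 0 ≤ |x + n| ^ (-(2 : ℝ)) := by positivity
    rw [Real.norm_of_nonneg (by positivity)]
    -- The exponent 3/2 dominates for bases at least 1, the exponent 2 for bases at most 1.
    rcases eq_or_lt_of_le (abs_nonneg (x + n)) with h | h
    · rw [← h, Real.zero_rpow (by linarith [ha.1])]
      rw [← h] at h1 h2
      linarith
    rcases le_total 1 |x + n| with h3 | h3
    · have := Real.rpow_le_rpow_of_exponent_le h3 (by linarith [ha.1] : -a ≤ -(3 / 2))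
      linarith
    · have := Real.rpow_le_rpow_of_exponent_ge h h3 (by linarith [ha.2] : -2 ≤ -a)
      linarith

theorem tendsto_integral_kern :
    Tendsto (fun a => ∫ x in Ioo (0 : ℝ) 1, kern a x) (𝓝[<] 2)
      (𝓝 (∫ x in Ioo (0 : ℝ) 1, kern 2 x)) := by
  have hmem : ∀ᶠ a : ℝ in 𝓝[<] 2, a ∈ Ioo (1 : ℝ) 2 := Ioo_mem_nhdsLT (by norm_num)
  refine tendsto_integral_filter_of_norm_le_const (hmem.mono fun a ha =>
    measurable_kern.aestronglyMeasurable) ⟨_, hmem.mono fun a ha =>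
    (ae_restrict_mem measurableSet_Ioo).mono fun x hx => abs_kern_le ha.1 ha.2.le hx⟩ ?_
  refine (ae_restrict_mem measurableSet_Ioo).mono fun x hx => ?_
  have h1 : ∀ y : ℝ, 0 < y → Tendsto (fun a : ℝ => y ^ (-2 * a)) (𝓝[<] 2) (𝓝 (y ^ (-2 * 2 : ℝ))) :=
    fun y hy => by
      have : ContinuousAt (fun a : ℝ => y ^ (-2 * a)) 2 :=
        ContinuousAt.rpow continuousAt_const (by fun_prop) (Or.inl hy.ne')
      exact this.tendsto.mono_left nhdsWithin_le_nhds
  exact ((((tendsto_latticeSum 0).sub (tendsto_latticeSum x)).pow 2).sub (h1 x hx.1)).sub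
    (h1 (1 - x) (by linarith [hx.2]))

/-! ### Identification with zeta functions and the value of K -/

theorem two_mul_hurwitzZetaEven {a : ℝ} (ha : 1 < a) (x : ℝ) :
    2 * HurwitzZeta.hurwitzZetaEven (x : UnitAddCircle) a = (latticeSum a x : ℂ) := by
  have h := (HurwitzZeta.hasSum_int_hurwitzZetaEven x (s := (a : ℂ)) (by simpa)).mul_left 2
  have h2 := Complex.hasSum_ofReal.2 (hasSum_latticeSum ha x)
  refine h.unique (h2.congr_fun fun n => ?_)
  rw [Complex.ofReal_cpow (abs_nonneg _), add_comm x, Complex.ofReal_neg, Complex.cpow_neg]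
  ring

theorem two_mul_riemannZeta {a : ℝ} (ha : 1 < a) :
    2 * riemannZeta a = (latticeSum a 0 : ℂ) := by
  rw [← two_mul_hurwitzZetaEven ha, QuotientAddGroup.mk_zero, HurwitzZeta.hurwitzZetaEven_zero]

theorem integrandK_eq_ofReal {a x : ℝ} (ha : 1 < a) (hx : x ∈ Ioo (0 : ℝ) 1) :
    integrandK a x = (kern a x : ℂ) := by
  -- On the circle 1-x is -x, so the two Hurwitz terms add up to twice the even part.
  have h1 : ((1 - x : ℝ) : UnitAddCircle) = -(x : UnitAddCircle) := by
    rw [AddCircle.coe_sub, AddCircle.coe_period, zero_sub]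
  have h2 : HurwitzZeta.hurwitzZeta (x : UnitAddCircle) a
      + HurwitzZeta.hurwitzZeta (-(x : UnitAddCircle)) a = (latticeSum a x : ℂ) := by
    rw [← two_mul_hurwitzZetaEven ha, HurwitzZeta.hurwitzZetaEven_eq]
    ring
  rw [integrandK, h1, sub_sub (2 * riemannZeta a), h2, two_mul_riemannZeta ha, kern]
  push_cast
  rw [Complex.ofReal_cpow hx.1.le, Complex.ofReal_cpow (by linarith [hx.2])]
  push_cast
  rfl

theorem intervalIntegrable_integrandK {a : ℝ} (ha : a ∈ Ioc (1 : ℝ) 2) :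
    IntervalIntegrable (integrandK a) volume 0 1 := by
  rw [intervalIntegrable_iff_integrableOn_Ioo_of_le zero_le_one,
    integrableOn_congr_fun (fun x hx => integrandK_eq_ofReal ha.1 hx) measurableSet_Ioo]
  exact (integrableOn_kern ha.1 ha.2).ofReal

theorem K_eq_ofReal {a : ℝ} (ha : 1 < a) :
    K a = ((∫ x in Ioo (0 : ℝ) 1, kern a x : ℝ) : ℂ) := by
  rw [K, intervalIntegral.integral_of_le zero_le_one, integral_Ioc_eq_integral_Ioo,
    setIntegral_congr_fun measurableSet_Ioo (fun x hx => integrandK_eq_ofReal ha hx),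
    integral_complex_ofReal]

theorem K_eq_closedFormK {a : ℝ} (ha : a ∈ Ioo (1 : ℝ) 2) : K a = closedFormK a := by
  rw [K_eq_ofReal ha.1, integral_kern ha.1 ha.2 (integrableOn_kern ha.1 ha.2.le), closedFormK,
    ← ofReal_integral_regProd ha.1 ha.2]
  have h := two_mul_riemannZeta (a := 2 * a - 1) (by linarith [ha.1])
  push_cast at h ⊢
  rw [h, ← two_mul_riemannZeta ha.1]
  ring

/-! ### Removable singularity at exponent 2 -/

/-- A meromorphic function that converges along a filter at a point converges at that point. -/
theorem tendsto_nhdsNE_of_meromorphicAt {f : ℂ → ℂ} {z c : ℂ} (hf : MeromorphicAt f z)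
    {l : Filter ℂ} [NeBot l] (hl : l ≤ 𝓝[≠] z) (h : Tendsto f l (𝓝 c)) :
    Tendsto f (𝓝[≠] z) (𝓝 c) := by
  have ho : 0 ≤ meromorphicOrderAt f z := by
    by_contra! hneg
    refine not_tendsto_atTop_of_tendsto_nhds h.norm ?_
    exact tendsto_norm_atTop_iff_cobounded.2
      ((tendsto_cobounded_of_meromorphicOrderAt_neg hneg).mono_left hl)
  obtain ⟨d, hd⟩ := tendsto_nhds_of_meromorphicOrderAt_nonneg hf ho
  rwa [tendsto_nhds_unique h (hd.mono_left hl)]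

theorem meromorphicAt_beta {f g : ℂ → ℂ} {z : ℂ} (hf : AnalyticAt ℂ f z) (hg : AnalyticAt ℂ g z) :
    MeromorphicAt (fun w => beta (f w) (g w)) z :=
  (((Meromorphic.Gamma _).comp_analyticAt hf).mul ((Meromorphic.Gamma _).comp_analyticAt hg)).div
    ((Meromorphic.Gamma _).comp_analyticAt (hf.add hg))

theorem analyticAt_riemannZeta {z : ℂ} (hz : z ≠ 1) : AnalyticAt ℂ riemannZeta z := by
  refine DifferentiableOn.analyticAt (s := {1}ᶜ)
    (fun w hw => (differentiableAt_riemannZeta hw).differentiableWithinAt) ?_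
  exact isOpen_compl_singleton.mem_nhds hz

theorem tendsto_ofReal_nhdsNE (x : ℝ) {l : Filter ℝ} (hl : l ≤ 𝓝[≠] x) :
    Tendsto (fun y : ℝ => (y : ℂ)) l (𝓝[≠] (x : ℂ)) := by
  refine Tendsto.mono_left ?_ hl
  refine tendsto_nhdsWithin_iff.2
    ⟨(Complex.continuous_ofReal.tendsto x).mono_left nhdsWithin_le_nhds, ?_⟩
  filter_upwards [self_mem_nhdsWithin] with y hy
  simpa using hy

/-- The identity with K on (1,2) and bounded convergence give the left limit; meromorphy in a
complex variable extends it to the right of 2. -/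
theorem tendsto_closedFormK : Tendsto closedFormK (𝓝[≠] 2) (𝓝 (K 2)) := by
  set G : ℂ → ℂ := fun z => 4 * riemannZeta z ^ 2
    + 2 * riemannZeta (2 * z - 1) * (2 * beta (1 - z) (2 * z - 1) + beta (1 - z) (1 - z))
    + 2 / (2 * z - 1) with hG
  have hmer : MeromorphicAt G ((2 : ℝ) : ℂ) := by
    have a1 : AnalyticAt ℂ (fun z : ℂ => 1 - z) ((2 : ℝ) : ℂ) := by fun_prop
    have a2 : AnalyticAt ℂ (fun z : ℂ => 2 * z - 1) ((2 : ℝ) : ℂ) := by fun_prop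
    have z1 : MeromorphicAt riemannZeta ((2 : ℝ) : ℂ) :=
      (analyticAt_riemannZeta (by norm_num)).meromorphicAt
    have z2 : MeromorphicAt (fun z : ℂ => riemannZeta (2 * z - 1)) ((2 : ℝ) : ℂ) :=
      (AnalyticAt.fun_comp (analyticAt_riemannZeta (by norm_num)) a2).meromorphicAt
    have b1 := meromorphicAt_beta a1 a2
    have b2 := meromorphicAt_beta a1 a1
    exact (((MeromorphicAt.const 4 _).mul (z1.pow 2)).add (((MeromorphicAt.const 2 _).mul z2).mul
      (((MeromorphicAt.const 2 _).mul b1).add b2))).add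
      ((MeromorphicAt.const 2 _).div a2.meromorphicAt)
  have hle : 𝓝[<] (2 : ℝ) ≤ 𝓝[≠] 2 := nhdsWithin_mono _ fun y hy => ne_of_lt hy
  have hleft : Tendsto closedFormK (𝓝[<] 2) (𝓝 (K 2)) := by
    rw [K_eq_ofReal one_lt_two]
    refine (Complex.continuous_ofReal.tendsto _ |>.comp tendsto_integral_kern).congr' ?_
    filter_upwards [Ioo_mem_nhdsLT (show (1 : ℝ) < 2 by norm_num)] with a ha
    rw [← K_eq_closedFormK ha, K_eq_ofReal ha.1]
    rfl
  have hmap : Tendsto G (map (fun y : ℝ => (y : ℂ)) (𝓝[<] 2)) (𝓝 (K 2)) := hleft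
  exact (tendsto_nhdsNE_of_meromorphicAt hmer (tendsto_ofReal_nhdsNE 2 hle) hmap).comp
    (tendsto_ofReal_nhdsNE 2 le_rfl)

/-! ### Propagators, image sums and their coincidence limits -/

/-- The amplitude of the bulk propagator. -/
def amplitude (ε : ℝ) : ℝ := 1 / 4 * Real.pi ^ (-2 + ε / 2) * Real.Gamma (1 - ε / 2)

theorem bulkPropagator_zero (ε h : ℝ) :
    bulkPropagator ε 0 h = amplitude ε * |h| ^ (-(2 - ε)) := by
  rw [bulkPropagator, amplitude, zero_pow two_ne_zero, zero_add, Real.sqrt_sq_eq_abs,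
    show -(2 - ε) = -2 + ε by ring]

theorem bulkPropagator_abs (ε r h : ℝ) : bulkPropagator ε r |h| = bulkPropagator ε r h := by
  rw [bulkPropagator, bulkPropagator, sq_abs]

/-- The bound is independent of r, so it serves as the majorant when r → 0 under the image sum. -/
theorem norm_bulkPropagator_le {ε : ℝ} (hε : ε ≤ 2) (r : ℝ) {h : ℝ} (hh : h ≠ 0) :
    ‖bulkPropagator ε r h‖ ≤ |amplitude ε| * |h| ^ (-(2 - ε)) := by
  have h1 : |h| ≤ √(r ^ 2 + h ^ 2) := Real.abs_le_sqrt (by nlinarith [sq_nonneg r])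
  have h0 : 0 < |h| := abs_pos.2 hh
  rw [bulkPropagator, ← amplitude, norm_mul, Real.norm_eq_abs, Real.norm_of_nonneg (by positivity),
    neg_sub, neg_add_eq_sub]
  gcongr ?_ * ?_
  exact Real.rpow_le_rpow_of_nonpos h0 h1 (by linarith)

theorem tendsto_bulkPropagator (ε : ℝ) {h : ℝ} (hh : h ≠ 0) :
    Tendsto (fun r => bulkPropagator ε r h) (𝓝[>] 0) (𝓝 (bulkPropagator ε 0 h)) := by
  have : ContinuousAt (fun r => bulkPropagator ε r h) 0 := by
    unfold bulkPropagator
    refine continuousAt_const.mul (ContinuousAt.rpow_const (by fun_prop) (Or.inl ?_))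
    positivity
  exact this.tendsto.mono_left nhdsWithin_le_nhds

theorem tendsto_halfSpace (ε : ℝ) {z : ℝ} (hz : 0 < z) :
    Tendsto (fun r => halfSpacePropagator ε r z z - bulkPropagator ε r 0)
      (𝓝[>] 0) (𝓝 (-(amplitude ε * (2 * z) ^ (-(2 - ε))))) := by
  have h := (tendsto_bulkPropagator ε (h := 2 * z) (by positivity)).neg
  rw [bulkPropagator_zero, abs_of_pos (by positivity)] at h
  refine h.congr fun r => ?_
  rw [halfSpacePropagator, sub_self, abs_zero, two_mul]
  ring

theorem halfSpaceSubtracted_eq (ε : ℝ) {z : ℝ} (hz : 0 < z) :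
    halfSpaceSubtracted ε z = -(amplitude ε * (2 * z) ^ (-(2 - ε))) :=
  (tendsto_halfSpace ε hz).limUnder_eq

theorem abs_image_rpow {L : ℝ} (hL : 0 < L) (a h : ℝ) (n : ℤ) :
    |h + 2 * L * n| ^ (-a) = (2 * L) ^ (-a) * |h / (2 * L) + n| ^ (-a) := by
  rw [← Real.mul_rpow (by positivity) (abs_nonneg _), ← abs_of_pos (show 0 < 2 * L by positivity),
    ← abs_mul, abs_of_pos (show 0 < 2 * L by positivity)]
  congr 2
  field_simp

theorem hasSum_image_rpow {L a : ℝ} (hL : 0 < L) (ha : 1 < a) (h : ℝ) :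
    HasSum (fun n : ℤ => |h + 2 * L * n| ^ (-a)) ((2 * L) ^ (-a) * latticeSum a (h / (2 * L))) :=
  ((hasSum_latticeSum ha (h / (2 * L))).mul_left ((2 * L) ^ (-a))).congr_fun
    fun n => abs_image_rpow hL a h n

theorem summable_bulkPropagator_images {ε L : ℝ} (hε : ε < 1) (hL : 0 < L) (r h : ℝ) :
    Summable fun n : ℤ => bulkPropagator ε r (h + 2 * L * n) := by
  refine Summable.of_norm_bounded_eventually
    (g := fun n : ℤ => |amplitude ε| * |h + 2 * L * n| ^ (-(2 - ε)))
    ((hasSum_image_rpow hL (by linarith) h).summable.mul_left _) ?_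
  -- The majorant fails only where an image sits at distance zero, which happens for at most one n.
  have hfin : {n : ℤ | h + 2 * L * n = 0}.Finite := by
    refine Set.Subsingleton.finite fun n hn m hm => ?_
    have hn : h + 2 * L * n = 0 := hn
    have hm : h + 2 * L * m = 0 := hm
    have : 2 * L * (n : ℝ) = 2 * L * m := by linarith
    exact_mod_cast mul_left_cancel₀ (by positivity) this
  filter_upwards [hfin.compl_mem_cofinite] with n hn
  exact norm_bulkPropagator_le (by linarith) r hn

theorem summable_filmTerm {ε L : ℝ} (hε : ε < 1) (hL : 0 < L) (r z₁ z₂ : ℝ) :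
    Summable (filmTerm ε L r z₁ z₂) := by
  unfold filmTerm
  simp_rw [bulkPropagator_abs]
  exact (summable_bulkPropagator_images hε hL r _).sub (summable_bulkPropagator_images hε hL r _)

/-- The subtracted bulk term is exactly the n = 0 direct image, and every other image stays at
positive distance since 0 < z < L. Dominated convergence then applies termwise; the missing direct
image agrees with the convention that a zero base contributes 0. -/
theorem tendsto_film {ε L z : ℝ} (hε : ε < 1) (hz : z ∈ Ioo 0 L) :
    Tendsto (fun r => filmPropagator ε L r z z - bulkPropagator ε r 0) (𝓝[>] 0)
      (𝓝 (amplitude ε * (2 * L) ^ (-(2 - ε))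
        * (latticeSum (2 - ε) 0 - latticeSum (2 - ε) (z / L)))) := by
  have hL : 0 < L := hz.1.trans hz.2
  have ha : 1 < 2 - ε := by linarith
  have hne : ∀ n : ℤ, z + z + 2 * L * n ≠ 0 := by
    intro n hn
    have h1 : z = -(L * n) := by linarith
    have h2 : 0 < -(n : ℝ) := by
      have := hz.1
      rw [h1, ← mul_neg] at this
      exact pos_of_mul_pos_right this hL.le
    have h3 : -(n : ℝ) < 1 := by
      have := hz.2
      rw [h1, ← mul_neg] at this
      nlinarith
    have h4 : 0 < -n := by exact_mod_cast h2
    have h5 : -n < 1 := by exact_mod_cast h3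
    omega
  have hne0 : ∀ n : ℤ, n ≠ 0 → 2 * L * (n : ℝ) ≠ 0 := fun n hn =>
    mul_ne_zero (by positivity) (by exact_mod_cast hn)
  have hS0 := hasSum_image_rpow hL ha 0
  have hS := hasSum_image_rpow hL ha (z + z)
  simp only [zero_add, zero_div] at hS0
  rw [← two_mul, mul_div_mul_left _ _ two_ne_zero, two_mul] at hS
  have hval := ((hS0.sub hS).mul_left (amplitude ε)).tsum_eq
  have hrw : amplitude ε * (2 * L) ^ (-(2 - ε))
        * (latticeSum (2 - ε) 0 - latticeSum (2 - ε) (z / L))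
      = ∑' n : ℤ, amplitude ε * (|2 * L * n| ^ (-(2 - ε)) - |z + z + 2 * L * n| ^ (-(2 - ε))) := by
    rw [hval]
    ring
  rw [hrw]
  have hterm : ∀ r, filmPropagator ε L r z z - bulkPropagator ε r 0
      = ∑' n : ℤ, (filmTerm ε L r z z n - if n = 0 then bulkPropagator ε r 0 else 0) := by
    intro r
    rw [(summable_filmTerm hε hL r z z).tsum_sub (hasSum_ite_eq _ _).summable, tsum_ite_eq]
    rfl
  have hsplit : ∀ (r : ℝ) (n : ℤ),
      (filmTerm ε L r z z n - if n = 0 then bulkPropagator ε r 0 else 0)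
        = (if n = 0 then 0 else bulkPropagator ε r (2 * L * n))
          - bulkPropagator ε r (z + z + 2 * L * n) := by
    intro r n
    rw [filmTerm, bulkPropagator_abs, sub_self, zero_add]
    split_ifs with h
    · subst h
      simp
    · ring
  simp_rw [hterm, hsplit]
  refine tendsto_tsum_of_dominated_convergence (bound := fun n : ℤ =>
    |amplitude ε| * (|2 * L * n| ^ (-(2 - ε)) + |z + z + 2 * L * n| ^ (-(2 - ε)))) ?_ ?_ ?_
  · exact (hS0.add hS).summable.mul_left _
  · intro n
    rw [mul_sub, ← bulkPropagator_zero, ← bulkPropagator_zero]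
    refine Tendsto.sub ?_ (tendsto_bulkPropagator ε (hne n))
    split_ifs with h
    · subst h
      rw [Int.cast_zero, mul_zero, bulkPropagator_zero, abs_zero, Real.zero_rpow (by linarith),
        mul_zero]
      exact tendsto_const_nhds
    · exact tendsto_bulkPropagator ε (hne0 n h)
  · refine Eventually.of_forall fun r n => ?_
    rw [mul_add]
    refine (norm_sub_le _ _).trans (add_le_add ?_ (norm_bulkPropagator_le (by linarith) r (hne n)))
    split_ifs with h
    · rw [norm_zero]
      positivity
    · exact norm_bulkPropagator_le (by linarith) r (hne0 n h)

theorem filmSubtracted_eq {ε L z : ℝ} (hε : ε < 1) (hz : z ∈ Ioo 0 L) :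
    filmSubtracted ε L z = amplitude ε * (2 * L) ^ (-(2 - ε))
      * (latticeSum (2 - ε) 0 - latticeSum (2 - ε) (z / L)) :=
  (tendsto_film hε hz).limUnder_eq

theorem halfSpaceSubtracted_sq (ε : ℝ) {z : ℝ} (hz : 0 < z) :
    halfSpaceSubtracted ε z ^ 2
      = amplitude ε ^ 2 * 2 ^ (-2 * (2 - ε)) * z ^ (-2 * (2 - ε)) := by
  have : ((2 * z) ^ (-(2 - ε))) ^ 2 = (2 : ℝ) ^ (-2 * (2 - ε)) * z ^ (-2 * (2 - ε)) := by
    rw [← Real.mul_rpow (by norm_num) hz.le, ← Real.rpow_natCast, ← Real.rpow_mul (by positivity)]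
    congr 1
    push_cast
    ring
  rw [halfSpaceSubtracted_eq ε hz, neg_sq, mul_pow, this]
  ring

theorem filmIntegrand_eq {ε L z : ℝ} (hε : ε < 1) (hz : z ∈ Ioo 0 L) :
    filmIntegrand ε L z = amplitude ε ^ 2 * 2 ^ (-2 * (2 - ε)) * L ^ (-2 * (2 - ε))
      * kern (2 - ε) (z / L) := by
  have hL : 0 < L := hz.1.trans hz.2
  have h2 : ∀ y : ℝ, 0 < y → y ^ (-2 * (2 - ε)) = L ^ (-2 * (2 - ε)) * (y / L) ^ (-2 * (2 - ε)) :=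
    fun y hy => by rw [← Real.mul_rpow hL.le (by positivity), mul_div_cancel₀ _ hL.ne']
  have h3 : ((2 * L) ^ (-(2 - ε))) ^ 2 = (2 : ℝ) ^ (-2 * (2 - ε)) * L ^ (-2 * (2 - ε)) := by
    rw [← Real.mul_rpow (by norm_num) hL.le, ← Real.rpow_natCast, ← Real.rpow_mul (by positivity)]
    congr 1
    push_cast
    ring
  have hLz : 0 < L - z := by linarith [hz.2]
  rw [filmIntegrand, filmSubtracted_eq hε hz, halfSpaceSubtracted_sq ε hz.1,
    halfSpaceSubtracted_sq ε hLz, h2 z hz.1, h2 _ hLz, kern, mul_pow, mul_pow, h3, sub_div,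
    div_self hL.ne']
  ring

theorem integrable_integral_filmIntegrand {ε L : ℝ} (hε : ε ∈ Ico (0 : ℝ) 1) (hL : 0 < L) :
    IntervalIntegrable (filmIntegrand ε L) volume 0 L ∧
      ∫ z in (0 : ℝ)..L, filmIntegrand ε L z = amplitude ε ^ 2 * 2 ^ (-2 * (2 - ε))
        * L ^ (1 - 2 * (2 - ε)) * ∫ x in Ioo (0 : ℝ) 1, kern (2 - ε) x := by
  have hk := integrableOn_kern (a := 2 - ε) (by linarith [hε.2]) (by linarith [hε.1])
  have hk1 : IntervalIntegrable (kern (2 - ε)) volume 0 1 :=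
    (intervalIntegrable_iff_integrableOn_Ioo_of_le zero_le_one).2 hk
  have hk2 := hk1.comp_mul_right (c := L⁻¹)
  simp only [div_inv_eq_mul, zero_mul, one_mul] at hk2
  have hk3 := hk2.const_mul (amplitude ε ^ 2 * 2 ^ (-2 * (2 - ε)) * L ^ (-2 * (2 - ε)))
  have heq : EqOn (filmIntegrand ε L) (fun z => amplitude ε ^ 2 * 2 ^ (-2 * (2 - ε))
      * L ^ (-2 * (2 - ε)) * kern (2 - ε) (z * L⁻¹)) (Ioo 0 L) := fun z hz => by
    rw [filmIntegrand_eq hε.2 hz, div_eq_mul_inv]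
  constructor
  · rw [intervalIntegrable_iff_integrableOn_Ioo_of_le hL.le] at hk3 ⊢
    exact (integrableOn_congr_fun heq measurableSet_Ioo).2 hk3
  · have hp : L ^ (1 - 2 * (2 - ε)) = L ^ (-2 * (2 - ε)) * L := by
      rw [← Real.rpow_add_one hL.ne']
      congr 1
      ring
    rw [intervalIntegral.integral_of_le hL.le, integral_Ioc_eq_integral_Ioo,
      setIntegral_congr_fun measurableSet_Ioo heq, ← integral_Ioc_eq_integral_Ioo,
      ← intervalIntegral.integral_of_le hL.le, intervalIntegral.integral_const_mul,
      intervalIntegral.integral_comp_mul_right _ (inv_ne_zero hL.ne'), zero_mul,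
      mul_inv_cancel₀ hL.ne', inv_inv, smul_eq_mul, intervalIntegral.integral_of_le zero_le_one,
      integral_Ioc_eq_integral_Ioo, hp]
    ring

theorem integrable_integral_halfSpace {ε L : ℝ} (hε : ε < 1) (hL : 0 < L) :
    IntegrableOn (fun z => halfSpaceSubtracted ε z ^ 2) (Ioi L) ∧
      ∫ z in Ioi L, halfSpaceSubtracted ε z ^ 2 = amplitude ε ^ 2 * 2 ^ (-2 * (2 - ε))
        * L ^ (1 - 2 * (2 - ε)) * (1 / (2 * (2 - ε) - 1)) := by
  have heq : EqOn (fun z => halfSpaceSubtracted ε z ^ 2) (fun z => amplitude ε ^ 2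
      * 2 ^ (-2 * (2 - ε)) * z ^ (-2 * (2 - ε))) (Ioi L) := fun z hz =>
    halfSpaceSubtracted_sq ε (hL.trans hz)
  have hi : IntegrableOn (fun z : ℝ => z ^ (-2 * (2 - ε))) (Ioi L) :=
    integrableOn_Ioi_rpow_of_lt (by linarith) hL
  constructor
  · exact (integrableOn_congr_fun heq measurableSet_Ioi).2 (hi.const_mul _)
  · rw [setIntegral_congr_fun measurableSet_Ioi heq, integral_const_mul,
      integral_Ioi_rpow_of_lt (by linarith) hL, ← neg_div_neg_eq, neg_neg,
      show -2 * (2 - ε) + 1 = 1 - 2 * (2 - ε) by ring, neg_sub]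
    ring

/-! ### The first-order coefficient and its uniqueness -/

/-- The amplitude of the first-order energy. -/
def energyAmplitude (ε : ℝ) : ℝ := 1 / 8 * (amplitude ε ^ 2 * 2 ^ (-2 * (2 - ε)))

/-- The first-order Casimir coefficient, as a real integral. -/
def casimirCoefficient (ε : ℝ) : ℝ :=
  energyAmplitude ε * ((∫ x in Ioo (0 : ℝ) 1, kern (2 - ε) x) - 2 / (2 * (2 - ε) - 1))

/-- Scaling z = L x extracts L^(-3+2ε), of which L^ε joins μ^ε. The energy is thus exactly linear in
g (μL)^ε, with no remainder. -/
theorem firstOrderEnergy_eq {ε L : ℝ} (hε : ε ∈ Ico (0 : ℝ) 1) (hL : 0 < L) {μ : ℝ} (hμ : 0 < μ)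
    (g : ℝ) : firstOrderEnergy ε g μ L
      = L ^ (-3 + ε) * casimirCoefficient ε * (g * (μ * L) ^ ε) := by
  have hp : L ^ (1 - 2 * (2 - ε)) = L ^ (-3 + ε) * L ^ ε := by
    rw [← Real.rpow_add hL]
    congr 1
    ring
  rw [firstOrderEnergy, (integrable_integral_filmIntegrand hε hL).2,
    (integrable_integral_halfSpace hε.2 hL).2, hp, casimirCoefficient, energyAmplitude,
    Real.mul_rpow hμ.le hL.le]
  ring

/-- For uniqueness, μ = L = 1 and running coupling g suffice: a nonzero multiple of g is not O(g²)
at 0. -/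
theorem isFirstCasimirCoefficient_iff {ε : ℝ} (hε : ε ∈ Ico (0 : ℝ) 1) (c : ℝ) :
    IsFirstCasimirCoefficient ε c ↔ c = casimirCoefficient ε := by
  constructor
  · intro h
    have h1 := h 1 1 one_pos one_pos (fun g => g) (by
      simp only [IsRunningCoupling, mul_one, Real.one_rpow, sub_self]
      exact isBigO_zero _ _)
    simp only [firstOrderEnergy_eq hε one_pos one_pos, mul_one, Real.one_rpow, one_mul,
      ← sub_mul] at h1
    have h2 : (fun g : ℝ => g ^ 2) =o[𝓝[>] 0] fun g : ℝ => g := by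
      have := (isLittleO_pow_id (𝕜 := ℝ) (n := 2) (by norm_num)).mono
        (nhdsWithin_le_nhds (s := Ioi (0 : ℝ)))
      exact this
    have h3 := h1.trans_isLittleO h2
    by_contra hne
    have h4 := (isLittleO_const_mul_left_iff (sub_ne_zero.2 hne)).1 h3
    have h5 := isLittleO_irrefl (f'' := fun g : ℝ => g) (l := 𝓝[>] (0 : ℝ)) (by
      refine Eventually.frequently ?_
      filter_upwards [self_mem_nhdsWithin] with g hg using ne_of_gt (show 0 < g from hg))
    exact h5 h4
  · rintro rfl μ L hμ hL gbar hg
    have : (fun g => L ^ (-3 + ε) * casimirCoefficient ε * gbar g - firstOrderEnergy ε g μ L)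
        = fun g => L ^ (-3 + ε) * casimirCoefficient ε * (gbar g - g * (μ * L) ^ ε) := by
      funext g
      rw [firstOrderEnergy_eq hε hL hμ]
      ring
    rw [this]
    exact hg.const_mul_left _

/-! ### The closed form of the coefficient and its limit at ε = 0 -/

/-- Reflection of Γ at a and at 2a-1, with sin π(2a-1) = -2 sin πa cos πa. At half-integers the zero
of the cosine matches the pole of Γ(2-2a). -/
theorem beta_reflection {a : ℝ} (ha : 1 / 2 < a) (hs : Complex.sin (Real.pi * a) ≠ 0) :
    beta (1 - a) (1 - a)
      = -2 * Complex.cos (Real.pi * a) * beta (1 - a) (2 * a - 1) := by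
  have hpi : (Real.pi : ℂ) ≠ 0 := by exact_mod_cast Real.pi_ne_zero
  have g1 := Complex.Gamma_mul_Gamma_one_sub (a : ℂ)
  have g2 := Complex.Gamma_mul_Gamma_one_sub (2 * a - 1 : ℂ)
  have hga : Complex.Gamma a ≠ 0 := Complex.Gamma_ne_zero_of_re_pos (by simp; linarith)
  have hgb : Complex.Gamma (2 * a - 1) ≠ 0 :=
    Complex.Gamma_ne_zero_of_re_pos (by simp; linarith)
  have hsin : Complex.sin (Real.pi * (2 * a - 1))
      = -2 * Complex.sin (Real.pi * a) * Complex.cos (Real.pi * a) := by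
    rw [show (Real.pi : ℂ) * (2 * a - 1) = 2 * (Real.pi * a) - Real.pi by ring,
      Complex.sin_sub_pi, Complex.sin_two_mul]
    ring
  have hinv : (Complex.Gamma (1 - (2 * a - 1)))⁻¹
      = Complex.Gamma (2 * a - 1) * Complex.sin (Real.pi * (2 * a - 1)) / Real.pi := by
    have := congrArg (fun t => t⁻¹) g2
    simp only [mul_inv, inv_div] at this
    rw [mul_div_assoc, ← this, mul_inv_cancel_left₀ hgb]
  have hg1 : Complex.Gamma (1 - a)
      = Real.pi / Complex.sin (Real.pi * a) / Complex.Gamma a := by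
    rw [eq_div_iff hga, mul_comm, g1]
  rw [beta, beta, show (1 : ℂ) - a + (1 - a) = 1 - (2 * a - 1) by ring,
    show (1 : ℂ) - a + (2 * a - 1) = a by ring, div_eq_mul_inv _ (Complex.Gamma (1 - _)), hinv,
    hsin, mul_assoc, hg1]
  field_simp

/-- Negative ε is included so that the limit at 0 can be two-sided; ε = 0 is excluded because
reflection needs sin πε ≠ 0. -/
theorem closedFormC_eq {ε : ℝ} (hε : ε < 1) (hε' : -1 < ε) (h0 : ε ≠ 0) :
    closedFormC ε
      = energyAmplitude ε * (closedFormK (2 - ε) - 2 / (2 * ((2 - ε : ℝ) : ℂ) - 1)) := by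
  have hpi : 0 < Real.pi := Real.pi_pos
  have hs : Complex.sin (Real.pi * ((2 - ε : ℝ) : ℂ)) ≠ 0 := by
    push_cast
    rw [show (Real.pi : ℂ) * (2 - ε) = 2 * Real.pi - Real.pi * ε by ring,
      Complex.sin_two_pi_sub, neg_ne_zero]
    intro h
    have h1 : Real.sin (Real.pi * ε) = 0 := by exact_mod_cast h
    have h2 := (Real.sin_eq_zero_iff_of_lt_of_lt (by nlinarith) (by nlinarith)).1 h1
    rcases mul_eq_zero.1 h2 with h3 | h3
    · exact hpi.ne' h3
    · exact h0 h3
  have hb := beta_reflection (a := 2 - ε) (by linarith) hs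
  have hcos : Complex.cos (Real.pi * ((2 - ε : ℝ) : ℂ)) = Complex.cos (Real.pi * ε) := by
    push_cast
    rw [show (Real.pi : ℂ) * (2 - ε) = 2 * Real.pi - Real.pi * ε by ring,
      Complex.cos_two_pi_sub]
  have hcomm : beta (3 - 2 * ε) (-1 + ε)
      = beta (1 - ((2 - ε : ℝ) : ℂ)) (2 * ((2 - ε : ℝ) : ℂ) - 1) := by
    rw [beta, beta]
    push_cast
    rw [show (1 : ℂ) - (2 - ε) = -1 + ε by ring, show 2 * ((2 : ℂ) - ε) - 1 = 3 - 2 * ε by ring,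
      mul_comm, add_comm (3 - 2 * (ε : ℂ))]
  -- The factor 4 is the one common to 4ζ(a)² and to 2ζ(2a-1) · 2B(1 - cos πε).
  have hreal : 1 / 2 * (4 * Real.pi) ^ (-4 + ε) * Real.Gamma (1 - ε / 2) ^ 2
      = 4 * energyAmplitude ε := by
    have e1 : (4 : ℝ) ^ (-4 + ε) = 1 / 16 * 2 ^ (-2 * (2 - ε)) := by
      rw [show (4 : ℝ) = 2 ^ (2 : ℝ) by norm_num, ← Real.rpow_mul (by norm_num),
        show (2 : ℝ) * (-(2 : ℝ) ^ (2 : ℝ) + ε) = -4 + -2 * (2 - ε) by norm_num; ring,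
        Real.rpow_add (by norm_num), show (-4 : ℝ) = ((-4 : ℤ) : ℝ) by norm_num, Real.rpow_intCast]
      norm_num
    have e2 : (Real.pi ^ (-2 + ε / 2)) ^ 2 = Real.pi ^ (-4 + ε) := by
      rw [← Real.rpow_natCast, ← Real.rpow_mul hpi.le]
      congr 1
      push_cast
      ring
    rw [Real.mul_rpow (by norm_num) hpi.le, e1, ← e2, energyAmplitude, amplitude]
    ring
  have hcplx : 1 / 2 * (4 * Real.pi : ℂ) ^ (-4 + ε : ℂ) * Complex.Gamma (1 - ε / 2) ^ 2
      = 4 * (energyAmplitude ε : ℂ) := by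
    have := congrArg (fun t : ℝ => (t : ℂ)) hreal
    push_cast [Complex.ofReal_cpow (show (0 : ℝ) ≤ 4 * Real.pi by positivity),
      ← Complex.Gamma_ofReal] at this
    exact this
  rw [closedFormC, hcplx, closedFormK, hb, hcos, hcomm]
  push_cast
  rw [show 2 * ((2 : ℂ) - ε) - 1 = 3 - 2 * ε by ring]
  ring

theorem ofReal_casimirCoefficient {ε : ℝ} (hε : ε < 1) :
    (casimirCoefficient ε : ℂ)
      = energyAmplitude ε * (K (2 - ε) - 2 / (2 * ((2 - ε : ℝ) : ℂ) - 1)) := by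
  rw [K_eq_ofReal (by linarith), casimirCoefficient]
  push_cast
  rfl

theorem continuousAt_energyAmplitude : ContinuousAt energyAmplitude 0 := by
  have h1 : ContinuousAt (fun ε : ℝ => Real.Gamma (1 - ε / 2)) 0 := by
    refine ContinuousAt.comp (g := Real.Gamma) (Real.differentiableAt_Gamma fun m => ?_).continuousAt
      (by fun_prop)
    have : (0 : ℝ) ≤ m := Nat.cast_nonneg m
    norm_num
    linarith
  have h2 : ContinuousAt (fun ε : ℝ => Real.pi ^ (-2 + ε / 2)) 0 :=
    ContinuousAt.rpow continuousAt_const (by fun_prop) (Or.inl Real.pi_ne_zero)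
  have h3 : ContinuousAt (fun ε : ℝ => (2 : ℝ) ^ (-2 * (2 - ε))) 0 :=
    ContinuousAt.rpow continuousAt_const (by fun_prop) (Or.inl two_ne_zero)
  unfold energyAmplitude amplitude
  exact continuousAt_const.mul ((((continuousAt_const.mul h2).mul h1).pow 2).mul h3)

theorem tendsto_closedFormC :
    Tendsto closedFormC (𝓝[≠] 0) (𝓝 (casimirCoefficient 0 : ℂ)) := by
  have h1 : Tendsto (fun ε : ℝ => 2 - ε) (𝓝[≠] 0) (𝓝[≠] 2) := by
    refine tendsto_nhdsWithin_iff.2 ⟨?_, ?_⟩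
    · have : ContinuousAt (fun ε : ℝ => 2 - ε) 0 := by fun_prop
      simpa using this.tendsto.mono_left (nhdsWithin_le_nhds (s := {0}ᶜ))
    · filter_upwards [self_mem_nhdsWithin] with ε hε
      simpa using hε
  have h2 := tendsto_closedFormK.comp h1
  have h3 : Tendsto (fun ε : ℝ => (energyAmplitude ε : ℂ)) (𝓝[≠] 0) (𝓝 (energyAmplitude 0 : ℂ)) :=
    ((Complex.continuous_ofReal.tendsto _).comp continuousAt_energyAmplitude.tendsto).mono_left
      nhdsWithin_le_nhds
  have h4 : Tendsto (fun ε : ℝ => 2 / (2 * ((2 - ε : ℝ) : ℂ) - 1)) (𝓝[≠] 0)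
      (𝓝 (2 / (2 * ((2 - 0 : ℝ) : ℂ) - 1))) := by
    have : ContinuousAt (fun ε : ℝ => 2 / (2 * ((2 - ε : ℝ) : ℂ) - 1)) 0 := by
      refine ContinuousAt.div continuousAt_const (by fun_prop) ?_
      norm_num
    exact this.tendsto.mono_left nhdsWithin_le_nhds
  rw [ofReal_casimirCoefficient zero_lt_one]
  have h5 := h3.mul (h2.sub h4)
  rw [sub_zero] at h5 ⊢
  refine h5.congr' ?_
  have hmem : ∀ᶠ ε : ℝ in 𝓝[≠] 0, ε ∈ Ioo (-1 : ℝ) 1 :=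
    nhdsWithin_le_nhds (Ioo_mem_nhds (by norm_num) (by norm_num))
  filter_upwards [self_mem_nhdsWithin, hmem] with ε h0 hε
  rw [closedFormC_eq hε.2 hε.1 h0]
  rfl

end Casimir

end

theorem mainTheorem5 :
    -- the integral `K(α)` for `1 < α ≤ 2`, the value at `α = 2` being the limit of the closed form
    (∀ α ∈ Ioc (1 : ℝ) 2, IntervalIntegrable (Casimir.integrandK α) volume 0 1) ∧
    (∀ α ∈ Ioo (1 : ℝ) 2, Casimir.K α = Casimir.closedFormK α) ∧
    Tendsto Casimir.closedFormK (𝓝[≠] 2) (𝓝 (Casimir.K 2)) ∧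
    -- the objects that define the Casimir coefficient are well defined
    (∀ ε ∈ Ico (0 : ℝ) 1,
      (∀ z : ℝ, 0 < z →
        Tendsto (fun r => Casimir.halfSpacePropagator ε r z z - Casimir.bulkPropagator ε r 0)
          (𝓝[>] 0) (𝓝 (Casimir.halfSpaceSubtracted ε z))) ∧
      ∀ L : ℝ, 0 < L →
        (∀ r z₁ z₂ : ℝ, 0 < r → Summable (Casimir.filmTerm ε L r z₁ z₂)) ∧
        (∀ z ∈ Ioo 0 L,
          Tendsto (fun r => Casimir.filmPropagator ε L r z z - Casimir.bulkPropagator ε r 0)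
            (𝓝[>] 0) (𝓝 (Casimir.filmSubtracted ε L z))) ∧
        IntervalIntegrable (Casimir.filmIntegrand ε L) volume 0 L ∧
        IntegrableOn (fun z => Casimir.halfSpaceSubtracted ε z ^ 2) (Ioi L)) ∧
    -- the coefficient `c₁(ε)` for `0 ≤ ε < 1`, the value at `ε = 0` being again a limit
    ∃ c₁ : ℝ → ℝ,
      (∀ ε ∈ Ico (0 : ℝ) 1, ∀ c : ℝ, Casimir.IsFirstCasimirCoefficient ε c ↔ c = c₁ ε) ∧
      (∀ ε ∈ Ioo (0 : ℝ) 1, (c₁ ε : ℂ) = Casimir.closedFormC ε) ∧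
      Tendsto Casimir.closedFormC (𝓝[≠] 0) (𝓝 (c₁ 0 : ℂ)) := by
  open Casimir in
  refine ⟨fun α hα => intervalIntegrable_integrandK hα, fun α hα => K_eq_closedFormK hα,
    tendsto_closedFormK, fun ε hε => ⟨fun z hz => tendsto_nhds_limUnder ⟨_, tendsto_halfSpace ε hz⟩,
      fun L hL => ⟨fun r z₁ z₂ _ => summable_filmTerm hε.2 hL r z₁ z₂,
        fun z hz => tendsto_nhds_limUnder ⟨_, tendsto_film hε.2 hz⟩,
        (integrable_integral_filmIntegrand hε hL).1, (integrable_integral_halfSpace hε.2 hL).1⟩⟩,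
    casimirCoefficient, fun ε hε c => isFirstCasimirCoefficient_iff hε c, fun ε hε => ?_,
    tendsto_closedFormC⟩
  rw [ofReal_casimirCoefficient hε.2, closedFormC_eq hε.2 (by linarith [hε.1]) hε.1.ne',
    K_eq_closedFormK ⟨by linarith [hε.2], by linarith [hε.1]⟩]
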